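/- **Proposition 5.11 (linear_quotients).** Let $(R,\mathfrak m,k)$ be either a noetherian local ring, or a standard graded algebra over a field $k$ with graded maximal ideal $\mathfrak m$ (that is, $R=\bigoplus_{n\ge 0}R_n$ is commutative, $R_0=k$, and $R$ is generated as a $k$-algebra by the finite-dimensional space $R_1$). In the second case all modules below are $\mathbb Z$-graded, and resolutions are graded. *Conventions.* Let $N$ be a finitely generated $R$-module with minimal free resolution $F$, so $\partial(F_i)\subseteq \mathfrak m F_{i-1}$. The linear part $\operatorname{lin}^R F$ is the associated graded complex of the filtration $(\mathcal G^nF)_i=\mathfrak m^{n-i}F_i$ (with $\mathfrak m^j=R$ for $j\le 0$), the linearity defect is $\operatorname{ld}_R N=\sup\{i: H_i(\operatorname{lin}^R F)\ne 0\}$ (and $0$ for $N=0$), and $N$ is a *Koszul module* if $\operatorname{ld}_R N=0$. The Betti number $\beta_s(N)$ is the rank of $F_s$, and $\operatorname{pd}_R N$ is the projective dimension. In the graded case, $\beta_{s,j}(N)=\dim_k \operatorname{Tor}^R_s(k,N)_j$ and $\operatorname{reg}_R N=\sup\{j-i:\operatorname{Tor}^R_i(k,N)_j\neq 0\}$. *Statement.*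 Let $M\ne 0$ be a finitely generated (graded) $R$-module with a minimal system of (homogeneous) generators $m_1,\dots,m_t$, put $I_i=(m_1,\dots,m_{i-1}):_R m_i$ for $1\le i\le t$, and suppose that every cyclic module $R/I_i$ is Koszul over $R$ (that is, $M$ has linear quotients). Then each submodule $(m_1,\dots,m_i)$ of $M$, $1\le i\le t$, is a Koszul module; in particular $M$ is a Koszul module. Moreover, $$\beta_s(M)=\sum_{i=1}^t\beta_s(R/I_i)\ \text{ for all } s\ge 0,\qquad \operatorname{pd}_R M=\max_{1\le i\le t}\operatorname{pd}_R(R/I_i).$$ In the graded case, if $\deg m_i=d_i\in\mathbb Z$, then also $$\beta_{s,j}(M)=\sum_{i=1}^t\beta_{s,j-d_i}(R/I_i)\ \text{ for all } s\ge 0,\ j\in\mathbb Z,\qquad \operatorname{reg}_R M=\max_{1\le i\le t}\{\operatorname{reg}_R(R/I_i)+d_i\}.$$ -/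

import Mathlib

universe u v

noncomputable section

namespace LinQuot

/-! ### Free resolutions, minimality, linear part -/

/-- A resolution `⋯ → F₁ → F₀ → M → 0` of the `R`-module `M` by free modules of finite rank,
`F i = R ^ (rank i)`. -/
structure FreeResolution (R : Type u) [CommRing R] (M : Type u) [AddCommGroup M] [Module R M] where
  /-- the rank of `F i` -/
  rank : ℕ → ℕ
  /-- the differential `F (i + 1) → F i` -/
  d : ∀ i, (Fin (rank (i + 1)) → R) →ₗ[R] (Fin (rank i) → R)
  /-- the augmentation `F 0 → M` -/
  aug : (Fin (rank 0) → R) →ₗ[R] M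
  aug_surjective : Function.Surjective aug
  exact_zero : Function.Exact (d 0) aug
  exact_succ : ∀ i, Function.Exact (d (i + 1)) (d i)

namespace FreeResolution

variable {R : Type u} [CommRing R] {M : Type u} [AddCommGroup M] [Module R M]

/-- The free module in homological degree `i`. -/
abbrev X (F : FreeResolution R M) (i : ℕ) : Type u := Fin (F.rank i) → R

/-- The resolution is minimal with respect to `𝔪`: the differential maps `F (i + 1)` into
`𝔪 F i`. -/
def IsMinimal (𝔪 : Ideal R) (F : FreeResolution R M) : Prop :=
  ∀ i, LinearMap.range (F.d i) ≤ 𝔪 • (⊤ : Submodule R (F.X i))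

/-- The filtration `(𝒢ⁿF) i = 𝔪^(n-i) F i`, where `𝔪^j = R` for `j ≤ 0` (so that the truncated
subtraction is the right one). The pieces with `n < 0` are all of `F` and contribute nothing to
the associated graded complex. -/
def filt (𝔪 : Ideal R) (F : FreeResolution R M) (n i : ℕ) : Submodule R (F.X i) :=
  𝔪 ^ (n - i) • ⊤

lemma filt_le_comap {𝔪 : Ideal R} {F : FreeResolution R M} (hF : F.IsMinimal 𝔪) (n i : ℕ) :
    F.filt 𝔪 n (i + 1) ≤ (F.filt 𝔪 n i).comap (F.d i) := by
  rw [← Submodule.map_le_iff_le_comap, filt, filt, Submodule.map_smul'', Submodule.map_top]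
  rcases Nat.lt_or_ge i n with h | h
  · obtain ⟨p, rfl⟩ : ∃ p, n = i + 1 + p := Nat.exists_eq_add_of_le h
    have h1 : i + 1 + p - (i + 1) = p := by omega
    have h2 : i + 1 + p - i = p + 1 := by omega
    rw [h1, h2, pow_succ, Submodule.mul_smul]
    exact Submodule.smul_mono le_rfl (hF i)
  · have h2 : n - i = 0 := by omega
    rw [h2, pow_zero, Ideal.one_eq_top, Submodule.top_smul]
    exact le_top

/-- The component `𝒢ⁿ(F i) / 𝒢ⁿ⁺¹(F i)` of the associated graded complex. -/
abbrev lin (𝔪 : Ideal R) (F : FreeResolution R M) (n i : ℕ) : Type u :=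
  (F.filt 𝔪 n i) ⧸ ((F.filt 𝔪 (n + 1) i).submoduleOf (F.filt 𝔪 n i))

/-- The differential of the linear part, induced by that of `F`. -/
def linD {𝔪 : Ideal R} {F : FreeResolution R M} (hF : F.IsMinimal 𝔪) (n i : ℕ) :
    F.lin 𝔪 n (i + 1) →ₗ[R] F.lin 𝔪 n i :=
  Submodule.mapQ _ _ ((F.d i).restrict (filt_le_comap hF n i))
    (fun _ hx => filt_le_comap hF (n + 1) i hx)

/-- The cycles of the linear part in homological degree `i`. -/
def linZ {𝔪 : Ideal R} {F : FreeResolution R M} (hF : F.IsMinimal 𝔪) (n : ℕ) :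
    (i : ℕ) → Submodule R (F.lin 𝔪 n i)
  | 0 => ⊤
  | i + 1 => LinearMap.ker (linD hF n i)

/-- The homology `H i` of the linear part, in degree `n`; the whole `H i` is the direct sum of
these over `n`. -/
abbrev linH {𝔪 : Ideal R} {F : FreeResolution R M} (hF : F.IsMinimal 𝔪) (n i : ℕ) : Type u :=
  (linZ hF n i) ⧸ ((LinearMap.range (linD hF n i)).submoduleOf (linZ hF n i))

/-- `sup {i : H i (lin F) ≠ 0}`; it is `0` if all the homology vanishes. -/
def linDefect {𝔪 : Ideal R} {F : FreeResolution R M} (hF : F.IsMinimal 𝔪) : ℕ∞ :=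
  ⨆ (i : ℕ) (_ : ∃ n, Nontrivial (linH hF n i)), (i : ℕ∞)

end FreeResolution

/-! ### Invariants over a local ring

A minimal free resolution of a finitely generated module over a noetherian local ring exists and is
unique up to isomorphism, so each infimum below is the value on any one of them. -/

section Local

variable (R : Type u) [CommRing R] [IsLocalRing R] (M : Type u) [AddCommGroup M] [Module R M]

/-- The minimal free resolutions of `M`. -/
abbrev MinRes : Type u :=
  {F : FreeResolution R M // F.IsMinimal (IsLocalRing.maximalIdeal R)}

/-- The linearity defect `ld_R M`. -/
def linearityDefect : ℕ∞ :=
  ⨅ F : MinRes R M, FreeResolution.linDefect F.2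

/-- `M` is a Koszul module. -/
def IsKoszul : Prop := linearityDefect R M = 0

/-- The Betti number `β_s(M)`: the rank of the `s`-th module in a minimal free resolution. -/
def betti (s : ℕ) : ℕ := ⨅ F : MinRes R M, F.1.rank s

end Local

/-! ### Standard graded algebras and graded resolutions -/

/-- `R = ⨁ R_n` is a standard graded `k`-algebra: `R_n = 0` for `n < 0`, `R_0 = k`, and `R` is
generated over `k` by the finite-dimensional space `R_1`. -/
structure IsStandardGraded {k : Type v} [Field k] {R : Type u} [CommRing R] [Algebra k R]
    (𝒜 : ℤ → Submodule k R) : Prop where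
  nontrivial : Nontrivial R
  neg : ∀ n < 0, 𝒜 n = ⊥
  zero : ∀ x ∈ 𝒜 0, ∃ c : k, algebraMap k R c = x
  finite : FiniteDimensional k (𝒜 1)
  adjoin : Algebra.adjoin k (𝒜 1 : Set R) = ⊤

section Graded

variable {k : Type v} [Field k] {R : Type u} [CommRing R] [Algebra k R]

/-- The graded maximal ideal, generated by the homogeneous elements of positive degree. -/
def gradedMaximalIdeal (𝒜 : ℤ → Submodule k R) : Ideal R :=
  Ideal.span {x | ∃ n : ℤ, 0 < n ∧ x ∈ 𝒜 n}

/-- The grading of `R ⧸ I` induced by that of `R`. -/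
def quotGrading (𝒜 : ℤ → Submodule k R) (I : Ideal R) (n : ℤ) : AddSubgroup (R ⧸ I) :=
  (𝒜 n).toAddSubgroup.map (Submodule.mkQ I).toAddMonoidHom

/-- The grading of a submodule `N` induced by that of the ambient module. -/
def subGrading {M : Type u} [AddCommGroup M] [Module R M] (ℳ : ℤ → AddSubgroup M)
    (N : Submodule R M) (n : ℤ) : AddSubgroup N :=
  (ℳ n).comap N.subtype.toAddMonoidHom

/-- A graded free resolution of the graded module `M = ⨁ ℳ n` over `R = ⨁ 𝒜 n`: the basis vector
`e_a` of `F i` has degree `deg i a`, i.e. `F i = ⨁_a R(-deg i a)`, and all the maps preserve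
degrees. -/
structure GradedFreeResolution (𝒜 : ℤ → Submodule k R) {M : Type u} [AddCommGroup M] [Module R M]
    (ℳ : ℤ → AddSubgroup M) extends FreeResolution R M where
  deg : ∀ i, Fin (rank i) → ℤ
  d_mem : ∀ i a b, d i (Pi.single a 1) b ∈ 𝒜 (deg (i + 1) a - deg i b)
  aug_mem : ∀ a, aug (Pi.single a 1) ∈ ℳ (deg 0 a)

namespace GradedFreeResolution

variable {𝒜 : ℤ → Submodule k R} {M : Type u} [AddCommGroup M] [Module R M] {ℳ : ℤ → AddSubgroup M}

/-- The degree `j` component of `F i = ⨁_a R(-deg i a)`. -/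
def piece (F : GradedFreeResolution 𝒜 ℳ) (i : ℕ) (j : ℤ) : Submodule k (F.X i) where
  carrier := {x | ∀ a, x a ∈ 𝒜 (j - F.deg i a)}
  add_mem' hx hy a := add_mem (hx a) (hy a)
  zero_mem' _ := zero_mem _
  smul_mem' c _ hx a := Submodule.smul_mem _ c (hx a)

/-- The elements of `𝔪 F i`, as a `k`-subspace. -/
def maxPart (F : GradedFreeResolution 𝒜 ℳ) (i : ℕ) : Submodule k (F.X i) :=
  (gradedMaximalIdeal 𝒜 • (⊤ : Submodule R (F.X i))).restrictScalars k

lemma piece_le_comap [GradedAlgebra 𝒜] (F : GradedFreeResolution 𝒜 ℳ) (i : ℕ) (j : ℤ) :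
    F.piece (i + 1) j ≤ (F.piece i j).comap ((F.d i).restrictScalars k) := by
  intro x hx b
  have h : F.d i x = ∑ a, x a • F.d i (Pi.single a 1) := by
    conv_lhs => rw [pi_eq_sum_univ' x]
    rw [map_sum]
    exact Finset.sum_congr rfl fun a _ => by rw [map_smul]
  change F.d i x b ∈ _
  rw [h, Finset.sum_apply]
  refine sum_mem fun a _ => ?_
  have := SetLike.GradedMul.mul_mem (hx a) (F.d_mem i a b)
  rwa [sub_add_sub_cancel] at this

lemma maxPart_le_comap (F : GradedFreeResolution 𝒜 ℳ) (i : ℕ) :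
    F.maxPart (i + 1) ≤ (F.maxPart i).comap ((F.d i).restrictScalars k) := by
  intro x hx
  change F.d i x ∈ gradedMaximalIdeal 𝒜 • (⊤ : Submodule R (F.X i))
  have h : F.d i x ∈ (gradedMaximalIdeal 𝒜 • (⊤ : Submodule R (F.X (i + 1)))).map (F.d i) :=
    Submodule.mem_map_of_mem hx
  rw [Submodule.map_smul''] at h
  exact Submodule.smul_mono le_rfl le_top h

/-- The degree `j` component of `k ⊗ F i = F i / 𝔪 F i`. -/
abbrev red (F : GradedFreeResolution 𝒜 ℳ) (i : ℕ) (j : ℤ) : Type u :=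
  (F.piece i j) ⧸ ((F.maxPart i).submoduleOf (F.piece i j))

/-- The degree `j` component of the differential of `k ⊗ F`. -/
def redD [GradedAlgebra 𝒜] (F : GradedFreeResolution 𝒜 ℳ) (i : ℕ) (j : ℤ) :
    F.red (i + 1) j →ₗ[k] F.red i j :=
  Submodule.mapQ _ _ (((F.d i).restrictScalars k).restrict (F.piece_le_comap i j))
    (fun _ hx => F.maxPart_le_comap i hx)

/-- The degree `j` cycles of `k ⊗ F` in homological degree `i`. -/
def redZ [GradedAlgebra 𝒜] (F : GradedFreeResolution 𝒜 ℳ) (j : ℤ) :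
    (i : ℕ) → Submodule k (F.red i j)
  | 0 => ⊤
  | i + 1 => LinearMap.ker (F.redD i j)

/-- `Tor_i(k, M)_j`, computed as the degree `j` component of `H_i(k ⊗ F)`. -/
abbrev tor [GradedAlgebra 𝒜] (F : GradedFreeResolution 𝒜 ℳ) (i : ℕ) (j : ℤ) : Type u :=
  (F.redZ j i) ⧸ ((LinearMap.range (F.redD i j)).submoduleOf (F.redZ j i))

end GradedFreeResolution

/-! ### Invariants of graded modules

As in the local case, for finitely generated graded modules over a standard graded algebra each
infimum is the value on any one of the resolutions over which it is taken. -/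

variable (𝒜 : ℤ → Submodule k R) {M : Type u} [AddCommGroup M] [Module R M] (ℳ : ℤ → AddSubgroup M)

/-- The minimal graded free resolutions of `M`. -/
abbrev GradedMinRes : Type u :=
  {F : GradedFreeResolution 𝒜 ℳ // F.toFreeResolution.IsMinimal (gradedMaximalIdeal 𝒜)}

/-- The linearity defect of a graded module. -/
def gradedLinearityDefect : ℕ∞ :=
  ⨅ F : GradedMinRes 𝒜 ℳ, FreeResolution.linDefect F.2

/-- The graded module `M` is Koszul. -/
def IsGradedKoszul : Prop := gradedLinearityDefect 𝒜 ℳ = 0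

/-- The total Betti number `β_s(M)` of a graded module: the rank of the `s`-th module in a minimal
graded free resolution. -/
def totalBetti (s : ℕ) : ℕ := ⨅ F : GradedMinRes 𝒜 ℳ, F.1.rank s

/-- The graded Betti number `β_{s,j}(M) = dim_k Tor_s(k, M)_j`. -/
def gradedBetti [GradedAlgebra 𝒜] (s : ℕ) (j : ℤ) : ℕ :=
  ⨅ F : GradedFreeResolution 𝒜 ℳ, Module.finrank k (F.tor s j)

/-- The Castelnuovo–Mumford regularity `sup {j - i : Tor_i(k, M)_j ≠ 0}`. -/
def regularity [GradedAlgebra 𝒜] : EReal :=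
  ⨆ (i : ℕ) (j : ℤ) (_ : gradedBetti 𝒜 ℳ i j ≠ 0), (((j - i : ℤ) : ℝ) : EReal)

end Graded

/-! ### Generators and quotients -/

section Generators

variable {R : Type u} [CommRing R] {M : Type u} [AddCommGroup M] [Module R M] {t : ℕ}

/-- `m` is a minimal system of generators of `M`: it generates `M`, and none of its members can be
omitted. -/
def IsMinimalGenerators (m : Fin t → M) : Prop :=
  Submodule.span R (Set.range m) = ⊤ ∧ ∀ i, Submodule.span R (m '' {i}ᶜ) ≠ ⊤

/-- The submodule generated by the first `i` members of `m`. -/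
def initial (R : Type u) [CommRing R] {M : Type u} [AddCommGroup M] [Module R M] {t : ℕ}
    (m : Fin t → M) (i : ℕ) : Submodule R M :=
  Submodule.span R (m '' {j | (j : ℕ) < i})

/-- The ideal `(m_1, …, m_{i-1}) : m_i` (with members of `m` indexed from `0`, the submodule is
generated by the members that precede `m i`). -/
def colonIdeal (R : Type u) [CommRing R] {M : Type u} [AddCommGroup M] [Module R M] {t : ℕ}
    (m : Fin t → M) (i : Fin t) : Ideal R :=
  (initial R m i).colon {m i}

end Generators

/-- The projective dimension of a module, in `{-∞} ∪ ℕ ∪ {∞}`. -/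
def projDim (R : Type u) [CommRing R] (M : Type u) [AddCommGroup M] [Module R M] : WithBot ℕ∞ :=
  CategoryTheory.projectiveDimension (ModuleCat.of R M)

end LinQuot

end

namespace LinQuot

/-! ### Free modules of finite rank and powers of an ideal -/

section Basic

variable {R : Type u} [CommRing R]

/-! Koszulness is a strictness property: `ld = 0` says that some minimal resolution `F` has
d(F_{i+1}) ∩ 𝔪^{q+1}F_i = d(𝔪^q F_{i+1}) for all i and q (`linDefect_eq_zero_iff`). In this form it
passes through extensions whose connecting maps are minimal.

Put M_l = (m_1, …, m_l). The sequence 0 → M_{l-1} → M_l → R/I_l → 0, with the quotient shifted by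
d_l in the graded case, lets one glue resolutions F' of M_{l-1} and F'' of R/I_l along connecting
maps F''_{i+1} → F'_i. The point is to choose these with values in 𝔪F' (`exists_gluing`). At the
bottom this is possible because relations among minimal generators have coefficients in 𝔪, so that
I_l m_l ⊆ 𝔪M_{l-1}. Higher up, the element of F'_i to be lifted has one factor of 𝔪 from the
previous connecting map and one from the minimality of F''; it lies in 𝔪²F'_i, and strictness of F'
gives a lift in 𝔪F'_{i+1}. The glued resolution is then minimal and again strict
(`Gluing.isMinimal`, `Gluing.isLinear`), and induction on l continues.

Ranks and degrees of basis elements add up under gluing. Since any minimal resolution computes Betti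
numbers, graded Betti numbers and projective dimension (`rank_le`, `gradedBetti_eq_degCount`,
`projDim_le_iff`), the formulas follow; regularity is then read off from the graded Betti numbers.

Both cases run through one argument: `HomogeneousProjections` records the part of a grading needed
to make all choices homogeneous, and the local case uses the family in which everything is
homogeneous of every degree. -/

lemma mem_smul_top_pi_iff (I : Ideal R) {n : ℕ} {x : Fin n → R} :
    x ∈ I • (⊤ : Submodule R (Fin n → R)) ↔ ∀ a, x a ∈ I := by
  constructor
  · intro hx a
    refine Submodule.smul_induction_on hx (fun r hr y _ => ?_) (fun y z hy hz => ?_)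
    · exact I.mul_mem_right _ hr
    · exact I.add_mem hy hz
  · intro hx
    rw [pi_eq_sum_univ' x]
    exact sum_mem fun a _ => Submodule.smul_mem_smul (hx a) trivial

lemma mem_pow_zero_smul_top (I : Ideal R) {M : Type*} [AddCommGroup M] [Module R M] (x : M) :
    x ∈ I ^ 0 • (⊤ : Submodule R M) := by
  rw [pow_zero, Ideal.one_eq_top, Submodule.top_smul]
  trivial

lemma map_mem_smul_top (I : Ideal R) {M N : Type*} [AddCommGroup M] [Module R M]
    [AddCommGroup N] [Module R N] (f : M →ₗ[R] N) {x : M} (hx : x ∈ I • (⊤ : Submodule R M)) :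
    f x ∈ I • (⊤ : Submodule R N) := by
  have h := Submodule.mem_map_of_mem (f := f) hx
  rw [Submodule.map_smul''] at h
  exact Submodule.smul_mono le_rfl le_top h

lemma map_mem_pow_succ_smul_top (I : Ideal R) {M N : Type*} [AddCommGroup M] [Module R M]
    [AddCommGroup N] [Module R N] (f : M →ₗ[R] N) (hf : ∀ x, f x ∈ I • (⊤ : Submodule R N))
    {q : ℕ} {x : M} (hx : x ∈ I ^ q • (⊤ : Submodule R M)) :
    f x ∈ I ^ (q + 1) • (⊤ : Submodule R N) := by
  have h := Submodule.mem_map_of_mem (f := f) hx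
  rw [Submodule.map_smul''] at h
  rw [pow_succ, Submodule.mul_smul]
  refine Submodule.smul_mono le_rfl ?_ h
  rw [Submodule.map_le_iff_le_comap]
  exact fun y _ => hf y

lemma pi_linearMap_apply {n : ℕ} {N : Type*} [AddCommGroup N] [Module R N]
    (f : (Fin n → R) →ₗ[R] N) (x : Fin n → R) : f x = ∑ a, x a • f (Pi.single a 1) := by
  conv_lhs => rw [pi_eq_sum_univ' x]
  rw [map_sum]
  exact Finset.sum_congr rfl fun a _ => by rw [map_smul]

lemma map_mem_of_forall_single {n : ℕ} {N : Type*} [AddCommGroup N] [Module R N]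
    (f : (Fin n → R) →ₗ[R] N) (P : Submodule R N) (h : ∀ a, f (Pi.single a 1) ∈ P)
    (x : Fin n → R) : f x ∈ P := by
  rw [pi_linearMap_apply]
  exact sum_mem fun a _ => P.smul_mem _ (h a)

/-- Linear maps out of `R ^ n` may be prescribed on the standard basis. -/
lemma exists_linearMap_pi {n : ℕ} {N : Type*} [AddCommGroup N] [Module R N]
    (Q : Fin n → N → Prop) (h : ∀ a, ∃ y, Q a y) :
    ∃ f : (Fin n → R) →ₗ[R] N, ∀ a, Q a (f (Pi.single a 1)) := by
  choose y hy using h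
  refine ⟨Fintype.linearCombination R y, fun a => ?_⟩
  rw [Fintype.linearCombination_apply_single, one_smul]
  exact hy a

lemma pi_linearMap_ext {n : ℕ} {N : Type*} [AddCommGroup N] [Module R N]
    {f g : (Fin n → R) →ₗ[R] N} (h : ∀ a, f (Pi.single a 1) = g (Pi.single a 1)) (x : Fin n → R) :
    f x = g x := by
  rw [pi_linearMap_apply f, pi_linearMap_apply g]
  exact Finset.sum_congr rfl fun a _ => by rw [h]

/-- A dependent choice principle. -/
lemma exists_seq_of_step {A : ℕ → Type*} (P : ∀ n, A n → Prop) (r : ∀ n, A n → A (n + 1) → Prop)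
    (a₀ : A 0) (h₀ : P 0 a₀)
    (hs : ∀ n a, P n a → ∃ b, P (n + 1) b ∧ r n a b) :
    ∃ f : ∀ n, A n, (∀ n, P n (f n)) ∧ (∀ n, r n (f n) (f (n + 1))) ∧ f 0 = a₀ := by
  choose g hg using hs
  let F : ∀ n, {a : A n // P n a} := fun n =>
    Nat.rec ⟨a₀, h₀⟩ (fun n a => ⟨g n a.1 a.2, (hg n a.1 a.2).1⟩) n
  exact ⟨fun n => (F n).1, fun n => (F n).2, fun n => (hg n _ (F n).2).2, rfl⟩

end Basic

/-! ### Linear part and strictness of the differential -/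

namespace FreeResolution

variable {R : Type u} [CommRing R] {M : Type u} [AddCommGroup M] [Module R M]

lemma d_d (F : FreeResolution R M) (i : ℕ) (x : F.X (i + 2)) : F.d i (F.d (i + 1) x) = 0 :=
  (F.exact_succ i _).2 ⟨x, rfl⟩

lemma aug_d (F : FreeResolution R M) (x : F.X 1) : F.aug (F.d 0 x) = 0 :=
  (F.exact_zero _).2 ⟨x, rfl⟩

lemma IsMinimal.d_mem {𝔪 : Ideal R} {F : FreeResolution R M} (hF : F.IsMinimal 𝔪) (i : ℕ)
    (x : F.X (i + 1)) : F.d i x ∈ 𝔪 • (⊤ : Submodule R (F.X i)) :=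
  hF i ⟨x, rfl⟩

/-- A resolution is linear if its differentials are strict for the filtrations that define the
linear part. -/
def IsLinear (𝔪 : Ideal R) (F : FreeResolution R M) : Prop :=
  ∀ (i q : ℕ) (x : F.X (i + 1)), F.d i x ∈ 𝔪 ^ (q + 1) • (⊤ : Submodule R (F.X i)) →
    ∃ y ∈ 𝔪 ^ q • (⊤ : Submodule R (F.X (i + 1))), F.d i y = F.d i x

lemma linD_mk {𝔪 : Ideal R} {F : FreeResolution R M} (hF : F.IsMinimal 𝔪) (n i : ℕ)
    (x : F.X (i + 1)) (hx : x ∈ F.filt 𝔪 n (i + 1)) :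
    linD hF n i (Submodule.Quotient.mk ⟨x, hx⟩) =
      Submodule.Quotient.mk ⟨F.d i x, filt_le_comap hF n i hx⟩ := rfl

lemma subsingleton_linH_succ_iff {𝔪 : Ideal R} {F : FreeResolution R M} (hF : F.IsMinimal 𝔪)
    (n i : ℕ) : Subsingleton (linH hF n (i + 1)) ↔
      ∀ x ∈ F.filt 𝔪 n (i + 1), F.d i x ∈ F.filt 𝔪 (n + 1) i →
        ∃ y ∈ F.filt 𝔪 n (i + 2), x - F.d (i + 1) y ∈ F.filt 𝔪 (n + 1) (i + 1) := by
  rw [Submodule.Quotient.subsingleton_iff, Submodule.submoduleOf_eq_top]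
  constructor
  · intro h x hx hdx
    have h1 : (Submodule.Quotient.mk ⟨x, hx⟩ : F.lin 𝔪 n (i + 1)) ∈ linZ hF n (i + 1) := by
      change linD hF n i (Submodule.Quotient.mk ⟨x, hx⟩) = 0
      rw [linD_mk, Submodule.Quotient.mk_eq_zero]
      exact hdx
    obtain ⟨z, hz⟩ := h h1
    obtain ⟨⟨y, hy⟩, rfl⟩ := Submodule.Quotient.mk_surjective _ z
    refine ⟨y, hy, ?_⟩
    rw [linD_mk, eq_comm, Submodule.Quotient.eq] at hz
    exact hz
  · intro h z hz
    obtain ⟨⟨x, hx⟩, rfl⟩ := Submodule.Quotient.mk_surjective _ z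
    change linD hF n i (Submodule.Quotient.mk ⟨x, hx⟩) = 0 at hz
    rw [linD_mk, Submodule.Quotient.mk_eq_zero] at hz
    obtain ⟨y, hy, hxy⟩ := h x hx hz
    refine ⟨Submodule.Quotient.mk ⟨y, hy⟩, ?_⟩
    rw [linD_mk, eq_comm, Submodule.Quotient.eq]
    exact hxy

/-- Homology in degree 0 contributes only the value 0 to the supremum, so only positive homological
degrees matter. -/
lemma linDefect_eq_zero_iff_subsingleton {𝔪 : Ideal R} {F : FreeResolution R M}
    (hF : F.IsMinimal 𝔪) : linDefect hF = 0 ↔ ∀ n i, Subsingleton (linH hF n (i + 1)) := by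
  rw [linDefect, ← bot_eq_zero', iSup_eq_bot]
  simp only [iSup_eq_bot]
  constructor
  · intro h n i
    by_contra hn
    rw [not_subsingleton_iff_nontrivial] at hn
    have := h (i + 1) ⟨n, hn⟩
    simp at this
  · rintro h (_ | i) ⟨n, hn⟩
    · simp
    · exact absurd (h n i) (not_subsingleton_iff_nontrivial.2 hn)

/-- From acyclicity to strictness, a preimage is corrected by boundaries, moving it one power of 𝔪
deeper at a time; only q corrections are needed, so no completeness enters. Conversely, subtracting
a deeper preimage from a cycle of the linear part leaves a true cycle, hence a boundary, whose
preimage is again chosen deep by strictness. -/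
lemma linDefect_eq_zero_iff {𝔪 : Ideal R} {F : FreeResolution R M} (hF : F.IsMinimal 𝔪) :
    linDefect hF = 0 ↔ F.IsLinear 𝔪 := by
  rw [linDefect_eq_zero_iff_subsingleton]
  simp only [subsingleton_linH_succ_iff]
  constructor
  · intro h i q x hx
    suffices H : ∀ p ≤ q, ∃ y ∈ 𝔪 ^ p • (⊤ : Submodule R (F.X (i + 1))), F.d i y = F.d i x from
      H q le_rfl
    intro p
    induction p with
    | zero => exact fun _ => ⟨x, mem_pow_zero_smul_top 𝔪 x, rfl⟩
    | succ p ih =>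
      intro hp
      obtain ⟨y, hy, hyx⟩ := ih (by omega)
      have e1 : i + 1 + p - (i + 1) = p := by omega
      have e2 : i + 1 + p + 1 - i = p + 2 := by omega
      have e3 : i + 1 + p + 1 - (i + 1) = p + 1 := by omega
      -- Since p < q, the differential of `y` lies in 𝔪^{p+2}, so `y` is a cycle of the linear part
      -- in filtration degree i + 1 + p.
      obtain ⟨z, -, hz⟩ := h (i + 1 + p) i y (by rwa [filt, e1]) (by
        rw [filt, e2, hyx]
        exact Submodule.smul_mono (Ideal.pow_le_pow_right (by omega)) le_rfl hx)
      rw [filt, e3] at hz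
      refine ⟨_, hz, ?_⟩
      rw [map_sub, d_d, sub_zero, hyx]
  · intro h n i x hx hdx
    rw [filt] at hx hdx
    rcases Nat.lt_or_ge n (i + 1) with hn | hn
    · refine ⟨0, zero_mem _, ?_⟩
      rw [filt, Nat.sub_eq_zero_of_le (by omega), pow_zero, Ideal.one_eq_top, Submodule.top_smul]
      trivial
    · obtain ⟨p, rfl⟩ := Nat.exists_eq_add_of_le hn
      have e1 : i + 1 + p - (i + 1) = p := by omega
      have e2 : i + 1 + p + 1 - i = p + 1 + 1 := by omega
      have e3 : i + 1 + p + 1 - (i + 1) = p + 1 := by omega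
      have e4 : i + 1 + p - (i + 2) = p - 1 := by omega
      rw [e1] at hx
      rw [e2] at hdx
      obtain ⟨y, hy, hyx⟩ := h i (p + 1) x hdx
      obtain ⟨z, hz⟩ := (F.exact_succ i (x - y)).1 (by rw [map_sub, hyx, sub_self])
      simp only [filt, e3, e4]
      have hxy : x - y ∈ 𝔪 ^ p • (⊤ : Submodule R (F.X (i + 1))) :=
        sub_mem hx (Submodule.smul_mono (Ideal.pow_le_pow_right (by omega)) le_rfl hy)
      -- The exponent p - 1 is truncated: for p = 0 any preimage `z` will do, otherwise strictness
      -- one degree higher is needed.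
      rcases p with _ | p
      · exact ⟨z, mem_pow_zero_smul_top 𝔪 z, by rwa [hz, sub_sub_cancel]⟩
      · obtain ⟨w, hw, hwz⟩ := h (i + 1) p z (by rwa [hz])
        exact ⟨w, hw, by rwa [hwz, hz, sub_sub_cancel]⟩

end FreeResolution

/-! ### Comparison maps, homotopies and minimal ranks -/

namespace FreeResolution

variable {R : Type u} [CommRing R] {M : Type u} [AddCommGroup M] [Module R M]

/-- The comparison map between two resolutions, with prescribed constraints on the images of the
basis vectors. -/
lemma exists_comparison (F G : FreeResolution R M) (Q : ∀ i, Fin (F.rank i) → Set (G.X i))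
    (hQ₀ : ∀ a y, G.aug y = F.aug (Pi.single a 1) →
      ∃ y' ∈ Q 0 a, G.aug y' = F.aug (Pi.single a 1))
    (hQ : ∀ i a (φ : F.X i →ₗ[R] G.X i), (∀ b, φ (Pi.single b 1) ∈ Q i b) →
      ∀ y, G.d i y = φ (F.d i (Pi.single a 1)) →
        ∃ y' ∈ Q (i + 1) a, G.d i y' = φ (F.d i (Pi.single a 1))) :
    ∃ α : ∀ i, F.X i →ₗ[R] G.X i, (∀ i a, α i (Pi.single a 1) ∈ Q i a) ∧
      (∀ x, G.aug (α 0 x) = F.aug x) ∧ ∀ i x, G.d i (α (i + 1) x) = α i (F.d i x) := by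
  obtain ⟨φ₀, hφ₀⟩ := exists_linearMap_pi (R := R)
    (fun a (y : G.X 0) => y ∈ Q 0 a ∧ G.aug y = F.aug (Pi.single a 1))
    (fun a => by
      obtain ⟨y, hy⟩ := G.aug_surjective (F.aug (Pi.single a 1))
      exact hQ₀ a y hy)
  have haug : ∀ x, G.aug (φ₀ x) = F.aug x := fun x =>
    pi_linearMap_ext (f := G.aug ∘ₗ φ₀) (g := F.aug) (fun a => (hφ₀ a).2) x
  -- The invariant carries the solvability of the next lifting problem along with the constraint on
  -- basis vectors.
  obtain ⟨α, hα, hr, hα₀⟩ := exists_seq_of_step (A := fun i => F.X i →ₗ[R] G.X i)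
    (fun i φ => (∀ a, φ (Pi.single a 1) ∈ Q i a) ∧ ∀ x, ∃ y, G.d i y = φ (F.d i x))
    (fun i φ ψ => ∀ x, G.d i (ψ x) = φ (F.d i x)) φ₀
    ⟨fun a => (hφ₀ a).1, fun x => (G.exact_zero _).1 (by rw [haug, aug_d])⟩
    (fun i φ hφ => by
      obtain ⟨ψ, hψ⟩ := exists_linearMap_pi (R := R)
        (fun a (y : G.X (i + 1)) => y ∈ Q (i + 1) a ∧ G.d i y = φ (F.d i (Pi.single a 1)))
        (fun a => by
          obtain ⟨y, hy⟩ := hφ.2 (Pi.single a 1)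
          exact hQ i a φ hφ.1 y hy)
      have hd : ∀ x, G.d i (ψ x) = φ (F.d i x) := fun x =>
        pi_linearMap_ext (f := G.d i ∘ₗ ψ) (g := φ ∘ₗ F.d i) (fun a => (hψ a).2) x
      refine ⟨ψ, ⟨fun a => (hψ a).1, fun x => ?_⟩, hd⟩
      exact (G.exact_succ i _).1 (by rw [hd, d_d, map_zero]))
  exact ⟨α, fun i => (hα i).1, by rwa [hα₀], hr⟩

/-- An endomorphism of a resolution that lifts the zero map is null-homotopic. -/
lemma exists_homotopy (F : FreeResolution R M) (γ : ∀ i, F.X i →ₗ[R] F.X i)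
    (hγ₀ : ∀ x, F.aug (γ 0 x) = 0) (hγ : ∀ i x, F.d i (γ (i + 1) x) = γ i (F.d i x)) :
    ∃ h : ∀ i, F.X i →ₗ[R] F.X (i + 1), (∀ x, F.d 0 (h 0 x) = γ 0 x) ∧
      ∀ i x, F.d (i + 1) (h (i + 1) x) = γ (i + 1) x - h i (F.d i x) := by
  obtain ⟨h₀, hh₀⟩ := exists_linearMap_pi (R := R)
    (fun a (y : F.X 1) => F.d 0 y = γ 0 (Pi.single a 1))
    (fun a => (F.exact_zero _).1 (hγ₀ _))
  have hd₀ : ∀ x, F.d 0 (h₀ x) = γ 0 x := fun x =>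
    pi_linearMap_ext (f := F.d 0 ∘ₗ h₀) (g := γ 0) hh₀ x
  obtain ⟨h, -, hr, hh⟩ := exists_seq_of_step (A := fun i => F.X i →ₗ[R] F.X (i + 1))
    (fun i φ => ∀ x, ∃ y, F.d (i + 1) y = γ (i + 1) x - φ (F.d i x))
    (fun i φ ψ => ∀ x, F.d (i + 1) (ψ x) = γ (i + 1) x - φ (F.d i x)) h₀
    (fun x => (F.exact_succ 0 _).1 (by rw [map_sub, hγ, hd₀, sub_self]))
    (fun i φ hφ => by
      obtain ⟨ψ, hψ⟩ := exists_linearMap_pi (R := R)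
        (fun a (y : F.X (i + 2)) =>
          F.d (i + 1) y = γ (i + 1) (Pi.single a 1) - φ (F.d i (Pi.single a 1)))
        (fun a => hφ _)
      have hd : ∀ x, F.d (i + 1) (ψ x) = γ (i + 1) x - φ (F.d i x) := fun x =>
        pi_linearMap_ext (f := F.d (i + 1) ∘ₗ ψ) (g := γ (i + 1) - φ ∘ₗ F.d i) hψ x
      refine ⟨ψ, fun x => (F.exact_succ (i + 1) _).1 ?_, hd⟩
      rw [map_sub, hγ, hd, d_d, map_zero, sub_zero, sub_self])
  exact ⟨h, by rwa [hh], hr⟩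

/-- A chain endomorphism of a minimal resolution that lifts the identity is the identity
modulo `𝔪`. -/
lemma IsMinimal.sub_mem_of_lift_id {𝔪 : Ideal R} {F : FreeResolution R M} (hF : F.IsMinimal 𝔪)
    (γ : ∀ i, F.X i →ₗ[R] F.X i) (hγ₀ : ∀ x, F.aug (γ 0 x) = F.aug x)
    (hγ : ∀ i x, F.d i (γ (i + 1) x) = γ i (F.d i x)) (i : ℕ) (x : F.X i) :
    γ i x - x ∈ 𝔪 • (⊤ : Submodule R (F.X i)) := by
  -- The difference from the identity is dh + hd, and both terms land in 𝔪F by minimality.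
  obtain ⟨h, h₀, hs⟩ := F.exists_homotopy (fun i => γ i - LinearMap.id)
    (fun x => by simp [hγ₀]) (fun i x => by simp [hγ])
  rcases i with _ | i
  · have : γ 0 x - x = F.d 0 (h 0 x) := (h₀ x).symm
    rw [this]
    exact hF.d_mem _ _
  · have : γ (i + 1) x - x = F.d (i + 1) (h (i + 1) x) + h i (F.d i x) := by
      rw [hs, sub_add_cancel]; rfl
    rw [this]
    exact add_mem (hF.d_mem _ _) (map_mem_smul_top 𝔪 (h i) (hF.d_mem _ _))

lemma exists_comparison' (F G : FreeResolution R M) :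
    ∃ α : ∀ i, F.X i →ₗ[R] G.X i, (∀ x, G.aug (α 0 x) = F.aug x) ∧
      ∀ i x, G.d i (α (i + 1) x) = α i (F.d i x) := by
  obtain ⟨α, -, h⟩ := F.exists_comparison G (fun _ _ => Set.univ)
    (fun a y hy => ⟨y, trivial, hy⟩) (fun i a φ _ y hy => ⟨y, trivial, hy⟩)
  exact ⟨α, h⟩

/-- The ranks of a minimal resolution are the smallest possible ones. -/
lemma IsMinimal.rank_le {𝔪 : Ideal R} (h𝔪 : 𝔪 ≠ ⊤) {F : FreeResolution R M} (hF : F.IsMinimal 𝔪)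
    (G : FreeResolution R M) (i : ℕ) : F.rank i ≤ G.rank i := by
  obtain ⟨α, hα₀, hα⟩ := F.exists_comparison' G
  obtain ⟨β, hβ₀, hβ⟩ := G.exists_comparison' F
  have H := hF.sub_mem_of_lift_id (fun i => β i ∘ₗ α i) (fun x => by simp [hα₀, hβ₀])
    (fun i x => by simp [hα, hβ]) i
  have : Nontrivial (R ⧸ 𝔪) := Ideal.Quotient.nontrivial_iff.2 h𝔪
  -- Reduction modulo 𝔪 turns βα ≡ id into a left inverse over R/𝔪, so the reduction of α is
  -- injective; 𝔪 only has to be proper for the rank comparison.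
  have hBA : ((LinearMap.toMatrix' (β i)).map (Ideal.Quotient.mk 𝔪)) *
      ((LinearMap.toMatrix' (α i)).map (Ideal.Quotient.mk 𝔪)) = 1 := by
    rw [← Matrix.map_mul, ← LinearMap.toMatrix'_comp]
    ext a b
    rw [Matrix.map_apply, LinearMap.toMatrix'_apply]
    have h1 := (mem_smul_top_pi_iff 𝔪).1 (H (Pi.single b 1)) a
    rw [Pi.sub_apply, ← Ideal.Quotient.eq] at h1
    have h2 : Ideal.Quotient.mk 𝔪 ((Pi.single b 1 : F.X i) a) =
        (1 : Matrix (Fin (F.rank i)) (Fin (F.rank i)) (R ⧸ 𝔪)) a b := by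
      rw [Matrix.one_apply, Pi.single_apply]
      split_ifs <;> simp
    rw [← h2, ← h1]
  refine le_of_fin_injective (R ⧸ 𝔪)
    (Matrix.mulVecLin ((LinearMap.toMatrix' (α i)).map (Ideal.Quotient.mk 𝔪))) ?_
  refine Function.LeftInverse.injective
    (g := Matrix.mulVecLin ((LinearMap.toMatrix' (β i)).map (Ideal.Quotient.mk 𝔪))) fun x => ?_
  rw [Matrix.mulVecLin_apply, Matrix.mulVecLin_apply, Matrix.mulVec_mulVec, hBA, Matrix.one_mulVec]

end FreeResolution

/-! ### Projective dimension from a minimal resolution -/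

namespace FreeResolution

open CategoryTheory

variable {R : Type u} [CommRing R] {M : Type u} [AddCommGroup M] [Module R M]

/-- The resolution of the first syzygy module obtained by truncation. -/
def syzygy (F : FreeResolution R M) : FreeResolution R (LinearMap.ker F.aug) where
  rank i := F.rank (i + 1)
  d i := F.d (i + 1)
  aug := (F.d 0).codRestrict _ F.aug_d
  aug_surjective := fun ⟨x, hx⟩ => by
    obtain ⟨y, hy⟩ := (F.exact_zero x).1 hx
    exact ⟨y, Subtype.ext hy⟩
  exact_zero x := by
    rw [← F.exact_succ 0 x, ← Subtype.coe_inj]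
    rfl
  exact_succ i := F.exact_succ (i + 1)

lemma IsMinimal.syzygy {𝔪 : Ideal R} {F : FreeResolution R M} (hF : F.IsMinimal 𝔪) :
    F.syzygy.IsMinimal 𝔪 :=
  fun i => hF (i + 1)

lemma shortExact_syzygy (F : FreeResolution R M) :
    (ShortComplex.mk (ModuleCat.ofHom (LinearMap.ker F.aug).subtype) (ModuleCat.ofHom F.aug)
      (by ext x; exact x.2)).ShortExact := by
  refine ModuleCat.shortComplex_shortExact _ (fun x => ?_) Subtype.val_injective F.aug_surjective
  exact ⟨fun h => ⟨⟨x, h⟩, rfl⟩, by rintro ⟨y, rfl⟩; exact y.2⟩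

lemma projective_of_rank_one_eq_zero (F : FreeResolution R M) (h : F.rank 1 = 0) :
    Module.Projective R M := by
  have hinj : Function.Injective F.aug := by
    rw [injective_iff_map_eq_zero]
    intro x hx
    obtain ⟨y, rfl⟩ := (F.exact_zero x).1 hx
    have : IsEmpty (Fin (F.rank 1)) := by rw [h]; infer_instance
    rw [Subsingleton.elim y 0, map_zero]
  exact Module.Projective.of_equiv (LinearEquiv.ofBijective F.aug ⟨hinj, F.aug_surjective⟩)

/-- The augmentation splits, so its kernel K ⊆ 𝔪F_0 is a retract of F_0; hence K = 𝔪K and K is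
projective. Splitting F_1 → K then gives F_1 = 𝔪F_1, absurd for a nonzero free module and a proper
ideal. No Nakayama is used, so the argument also covers the graded maximal ideal. -/
lemma IsMinimal.rank_one_eq_zero {𝔪 : Ideal R} (h𝔪 : 𝔪 ≠ ⊤) {F : FreeResolution R M}
    (hF : F.IsMinimal 𝔪) [Module.Projective R M] : F.rank 1 = 0 := by
  obtain ⟨s, hs⟩ := Module.projective_lifting_property F.aug LinearMap.id F.aug_surjective
  have hs' : ∀ x, F.aug (s x) = x := fun x => LinearMap.congr_fun hs x
  -- the retraction onto the first syzygy
  let r : F.X 0 →ₗ[R] LinearMap.ker F.aug :=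
    (LinearMap.id - s ∘ₗ F.aug).codRestrict _ (fun x => by simp [hs'])
  have hr : ∀ x : LinearMap.ker F.aug, r x = x := fun x => by
    ext1
    have : F.aug x = 0 := x.2
    simp [r, this]
  have hproj : Module.Projective R (LinearMap.ker F.aug) :=
    Module.Projective.of_split (LinearMap.ker F.aug).subtype r (LinearMap.ext hr)
  let p : F.X 1 →ₗ[R] LinearMap.ker F.aug := F.syzygy.aug
  obtain ⟨s', hs'⟩ := Module.projective_lifting_property p LinearMap.id F.syzygy.aug_surjective
  have hs' : ∀ x, p (s' x) = x := fun x => LinearMap.congr_fun hs' x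
  have hK : ∀ x : LinearMap.ker F.aug, x ∈ 𝔪 • (⊤ : Submodule R (LinearMap.ker F.aug)) := by
    intro x
    rw [← hr x]
    obtain ⟨y, hy⟩ := (F.exact_zero x).1 x.2
    exact map_mem_smul_top 𝔪 r (hy ▸ hF.d_mem 0 y)
  have htop : ∀ x : F.X 1, x ∈ 𝔪 • (⊤ : Submodule R (F.X 1)) := by
    intro x
    have h1 : F.d 0 (x - s' (p x)) = 0 := by
      have := congrArg Subtype.val (hs' (p x))
      rw [map_sub, sub_eq_zero]
      exact this.symm
    obtain ⟨y, hy⟩ := (F.exact_succ 0 _).1 h1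
    rw [← sub_add_cancel x (s' (p x)), ← hy]
    exact add_mem (hF.d_mem 1 y) (map_mem_smul_top 𝔪 s' (hK _))
  by_contra h0
  let a : Fin (F.rank 1) := ⟨0, Nat.pos_of_ne_zero h0⟩
  have := (mem_smul_top_pi_iff 𝔪).1 (htop (Pi.single a 1)) a
  rw [Pi.single_eq_same] at this
  exact h𝔪 ((Ideal.eq_top_iff_one 𝔪).2 this)

/-- The projective dimension is read off from a minimal resolution. -/
lemma IsMinimal.hasProjectiveDimensionLE_iff {𝔪 : Ideal R} (h𝔪 : 𝔪 ≠ ⊤) (n : ℕ)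
    {M : Type u} [AddCommGroup M] [Module R M] {F : FreeResolution R M}
    (hF : F.IsMinimal 𝔪) :
    HasProjectiveDimensionLE (ModuleCat.of R M) n ↔ F.rank (n + 1) = 0 := by
  induction n generalizing M with
  | zero =>
    rw [← projective_iff_hasProjectiveDimensionLE_zero, ← IsProjective.iff_projective]
    exact ⟨fun h => hF.rank_one_eq_zero h𝔪, F.projective_of_rank_one_eq_zero⟩
  | succ n ih =>
    have : Projective (ModuleCat.of R (F.X 0)) := inferInstance
    -- Dimension shifting along 0 → K → F_0 → M → 0, with the truncation as minimal resolution of K.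
    exact (F.shortExact_syzygy.hasProjectiveDimensionLT_X₃_iff n this).trans (ih hF.syzygy)

lemma IsMinimal.projDim_le_iff {𝔪 : Ideal R} (h𝔪 : 𝔪 ≠ ⊤) {F : FreeResolution R M}
    (hF : F.IsMinimal 𝔪) (n : ℕ) : projDim R M ≤ n ↔ F.rank (n + 1) = 0 := by
  rw [projDim, projectiveDimension_le_iff, hF.hasProjectiveDimensionLE_iff h𝔪]

lemma projDim_ne_bot [Nontrivial M] : projDim R M ≠ ⊥ := by
  rw [projDim, Ne, projectiveDimension_eq_bot_iff, ModuleCat.isZero_of_iff_subsingleton]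
  exact not_subsingleton M

end FreeResolution

/-- Natural upper bounds determine everything except the bottom element, which they do not separate
from 0; hence the condition on `b`. -/
lemma WithBot.le_of_forall_le_natCast {a b : WithBot ℕ∞} (hb : b ≠ ⊥)
    (h : ∀ n : ℕ, b ≤ n → a ≤ n) : a ≤ b := by
  lift b to ℕ∞ using hb
  induction b with
  | top => exact le_top
  | coe n => exact h n le_rfl

/-- The projective dimension of a module one of whose minimal resolutions has the sum of the ranks
of minimal resolutions of the modules `N l`. -/
lemma projDim_eq_iSup {R : Type u} [CommRing R] {M : Type u} [AddCommGroup M] [Module R M]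
    [Nontrivial M] {𝔪 : Ideal R} (h𝔪 : 𝔪 ≠ ⊤) {F : FreeResolution R M} (hF : F.IsMinimal 𝔪)
    {ι : Type*} [Fintype ι] [Nonempty ι] {N : ι → Type u} [∀ l, AddCommGroup (N l)]
    [∀ l, Module R (N l)] [∀ l, Nontrivial (N l)] {G : ∀ l, FreeResolution R (N l)}
    (hG : ∀ l, (G l).IsMinimal 𝔪) (h : ∀ s, F.rank s = ∑ l, (G l).rank s) :
    projDim R M = ⨆ l, projDim R (N l) := by
  have hbot : ⨆ l, projDim R (N l) ≠ ⊥ := fun hbot => by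
    obtain ⟨l⟩ := ‹Nonempty ι›
    exact FreeResolution.projDim_ne_bot (R := R) (M := N l) (iSup_eq_bot.1 hbot l)
  have key : ∀ n : ℕ, projDim R M ≤ n ↔ ⨆ l, projDim R (N l) ≤ n := fun n => by
    rw [hF.projDim_le_iff h𝔪, iSup_le_iff, h, Finset.sum_eq_zero_iff]
    simp only [Finset.mem_univ, true_implies]
    exact forall_congr' fun l => ((hG l).projDim_le_iff h𝔪 n).symm
  exact le_antisymm (WithBot.le_of_forall_le_natCast hbot fun n => (key n).2)
    (WithBot.le_of_forall_le_natCast FreeResolution.projDim_ne_bot fun n => (key n).1)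

end LinQuot

noncomputable section

namespace LinQuot

/-! ### Gluing resolutions along an extension -/

section Split

variable {R : Type u} [CommRing R]

/-- The decomposition `R ^ (a + b) = R ^ a × R ^ b`. -/
def splitEquiv (R : Type u) [CommRing R] (a b : ℕ) :
    (Fin (a + b) → R) ≃ₗ[R] (Fin a → R) × (Fin b → R) :=
  LinearEquiv.funCongrLeft R R finSumFinEquiv ≪≫ₗ
    LinearEquiv.sumArrowLequivProdArrow (Fin a) (Fin b) R R

lemma splitEquiv_fst {a b : ℕ} (x : Fin (a + b) → R) (i : Fin a) :
    (splitEquiv R a b x).1 i = x (Fin.castAdd b i) := rfl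

lemma splitEquiv_snd {a b : ℕ} (x : Fin (a + b) → R) (i : Fin b) :
    (splitEquiv R a b x).2 i = x (Fin.natAdd a i) := rfl

lemma splitEquiv_single_castAdd {a b : ℕ} (i : Fin a) :
    splitEquiv R a b (Pi.single (Fin.castAdd b i) 1) = (Pi.single i 1, 0) := by
  ext j
  · simp [splitEquiv_fst, Pi.single_apply]
  · rw [splitEquiv_snd, Pi.single_eq_of_ne]
    · rfl
    · intro h
      have := congrArg Fin.val h
      simp at this
      omega

lemma splitEquiv_single_natAdd {a b : ℕ} (i : Fin b) :
    splitEquiv R a b (Pi.single (Fin.natAdd a i) 1) = (0, Pi.single i 1) := by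
  ext j
  · rw [splitEquiv_fst, Pi.single_eq_of_ne]
    · rfl
    · intro h
      have := congrArg Fin.val h
      simp at this
      omega
  · simp [splitEquiv_snd, Pi.single_apply]

lemma mem_smul_top_split_iff (I : Ideal R) {a b : ℕ} {x : Fin (a + b) → R} :
    x ∈ I • (⊤ : Submodule R (Fin (a + b) → R)) ↔
      (splitEquiv R a b x).1 ∈ I • (⊤ : Submodule R (Fin a → R)) ∧
      (splitEquiv R a b x).2 ∈ I • (⊤ : Submodule R (Fin b → R)) := by
  simp only [mem_smul_top_pi_iff, splitEquiv_fst, splitEquiv_snd]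
  exact ⟨fun h => ⟨fun i => h _, fun i => h _⟩, fun h i => Fin.addCases h.1 h.2 i⟩

end Split

namespace FreeResolution

variable {R : Type u} [CommRing R] {N N' N'' : Type u} [AddCommGroup N] [Module R N]
  [AddCommGroup N'] [Module R N'] [AddCommGroup N''] [Module R N'']

/-- The data that glue resolutions of `N'` and `N''` to a resolution of an extension `N` of `N''`
by `N'`. -/
structure Gluing (F' : FreeResolution R N') (F'' : FreeResolution R N'') (N : Type u)
    [AddCommGroup N] [Module R N] where
  /-- the inclusion `N' → N` -/
  incl : N' →ₗ[R] N
  /-- a lift of the augmentation of `F''` -/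
  lift : F''.X 0 →ₗ[R] N
  /-- the connecting maps -/
  conn : ∀ i, F''.X (i + 1) →ₗ[R] F'.X i
  incl_injective : Function.Injective incl
  exists_eq : ∀ n, ∃ x y, incl x + lift y = n
  aug_eq_zero : ∀ x y, incl x + lift y = 0 → F''.aug y = 0
  conn_zero : ∀ x, incl (F'.aug (conn 0 x)) + lift (F''.d 0 x) = 0
  conn_succ : ∀ i x, F'.d i (conn (i + 1) x) + conn i (F''.d (i + 1) x) = 0

namespace Gluing

variable {F' : FreeResolution R N'} {F'' : FreeResolution R N''} (g : Gluing F' F'' N)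

/-- The differential of the glued resolution. -/
def d (i : ℕ) : (Fin (F'.rank (i + 1) + F''.rank (i + 1)) → R) →ₗ[R]
    (Fin (F'.rank i + F''.rank i) → R) :=
  (splitEquiv R _ _).symm.toLinearMap ∘ₗ
    ((F'.d i ∘ₗ LinearMap.fst R _ _ + g.conn i ∘ₗ LinearMap.snd R _ _).prod
      (F''.d i ∘ₗ LinearMap.snd R _ _)) ∘ₗ (splitEquiv R _ _).toLinearMap

lemma split_d (i : ℕ) (x : Fin (F'.rank (i + 1) + F''.rank (i + 1)) → R) :
    splitEquiv R _ _ (g.d i x) =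
      (F'.d i (splitEquiv R _ _ x).1 + g.conn i (splitEquiv R _ _ x).2,
        F''.d i (splitEquiv R _ _ x).2) := by
  simp [d]

/-- The augmentation of the glued resolution. -/
def aug : (Fin (F'.rank 0 + F''.rank 0) → R) →ₗ[R] N :=
  ((g.incl ∘ₗ F'.aug).coprod g.lift) ∘ₗ (splitEquiv R _ _).toLinearMap

lemma aug_apply (x : Fin (F'.rank 0 + F''.rank 0) → R) :
    g.aug x = g.incl (F'.aug (splitEquiv R _ _ x).1) + g.lift (splitEquiv R _ _ x).2 := by
  simp [aug]

/-- Diagram chase: the second component is a boundary d''z, and correcting the first component by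
`conn 0 z` puts it in the kernel of the augmentation of F'. The signs are absorbed into the
connecting maps. -/
lemma exact_zero : Function.Exact (g.d 0) g.aug := by
  intro x
  rw [aug_apply]
  constructor
  · intro h
    obtain ⟨z, hz⟩ := (F''.exact_zero _).1 (g.aug_eq_zero _ _ h)
    have h1 : F'.aug ((splitEquiv R _ _ x).1 - g.conn 0 z) = 0 := by
      apply g.incl_injective
      have := g.conn_zero z
      rw [hz, add_eq_zero_iff_eq_neg] at this
      rw [map_sub, map_sub, this, sub_neg_eq_add, h, map_zero]
    obtain ⟨w, hw⟩ := (F'.exact_zero _).1 h1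
    refine ⟨(splitEquiv R _ _).symm (w, z), (splitEquiv R _ _).injective ?_⟩
    rw [split_d, LinearEquiv.apply_symm_apply, hw, hz, sub_add_cancel]
  · rintro ⟨y, rfl⟩
    rw [split_d]
    simp only [map_add, aug_d, zero_add]
    exact g.conn_zero _

lemma exact_succ (i : ℕ) : Function.Exact (g.d (i + 1)) (g.d i) := by
  intro x
  rw [← (splitEquiv R _ _).map_eq_zero_iff, split_d, Prod.mk_eq_zero]
  constructor
  · rintro ⟨h', h''⟩
    obtain ⟨z, hz⟩ := (F''.exact_succ i _).1 h''
    have h1 : F'.d i ((splitEquiv R _ _ x).1 - g.conn (i + 1) z) = 0 := by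
      have := g.conn_succ i z
      rw [hz, add_eq_zero_iff_eq_neg] at this
      rw [map_sub, this, sub_neg_eq_add, h']
    obtain ⟨w, hw⟩ := (F'.exact_succ i _).1 h1
    refine ⟨(splitEquiv R _ _).symm (w, z), (splitEquiv R _ _).injective ?_⟩
    rw [split_d, LinearEquiv.apply_symm_apply, hw, hz, sub_add_cancel]
  · rintro ⟨y, rfl⟩
    rw [split_d]
    simp only [map_add, d_d, zero_add, and_true]
    exact g.conn_succ i _

/-- The glued resolution. -/
def resolution : FreeResolution R N where
  rank i := F'.rank i + F''.rank i
  d := g.d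
  aug := g.aug
  aug_surjective n := by
    obtain ⟨x, y, rfl⟩ := g.exists_eq n
    obtain ⟨x, rfl⟩ := F'.aug_surjective x
    exact ⟨(splitEquiv R _ _).symm (x, y), by simp [aug_apply]⟩
  exact_zero := g.exact_zero
  exact_succ := g.exact_succ

/-- The decomposition of the terms of the glued resolution. -/
def split (i : ℕ) : g.resolution.X i ≃ₗ[R] F'.X i × F''.X i :=
  splitEquiv R _ _

lemma split_resolution_d (i : ℕ) (x : g.resolution.X (i + 1)) :
    g.split i (g.resolution.d i x) =
      (F'.d i (g.split (i + 1) x).1 + g.conn i (g.split (i + 1) x).2,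
        F''.d i (g.split (i + 1) x).2) :=
  g.split_d i x

lemma mem_smul_top_iff (I : Ideal R) (i : ℕ) (x : g.resolution.X i) :
    x ∈ I • (⊤ : Submodule R (g.resolution.X i)) ↔
      (g.split i x).1 ∈ I • (⊤ : Submodule R (F'.X i)) ∧
      (g.split i x).2 ∈ I • (⊤ : Submodule R (F''.X i)) :=
  mem_smul_top_split_iff I

variable {𝔪 : Ideal R}

lemma isMinimal (hF' : F'.IsMinimal 𝔪) (hF'' : F''.IsMinimal 𝔪)
    (hg : ∀ i x, g.conn i x ∈ 𝔪 • (⊤ : Submodule R (F'.X i))) : g.resolution.IsMinimal 𝔪 := by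
  rintro i _ ⟨x, rfl⟩
  rw [mem_smul_top_iff, split_resolution_d]
  exact ⟨add_mem (hF'.d_mem _ _) (hg _ _), hF''.d_mem _ _⟩

/-- Strictness of F'' replaces the second component by some v ∈ 𝔪^q F'', changing it by a boundary
d''z; the first component is compensated by `conn (i + 1) z`. Since `conn` takes values in 𝔪F', it
sends v into 𝔪^{q+1}F', so strictness of F' applies to what remains. -/
lemma isLinear (hF' : F'.IsLinear 𝔪) (hF'' : F''.IsLinear 𝔪)
    (hg : ∀ i x, g.conn i x ∈ 𝔪 • (⊤ : Submodule R (F'.X i))) : g.resolution.IsLinear 𝔪 := by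
  intro i q x hx
  rw [mem_smul_top_iff, split_resolution_d] at hx
  obtain ⟨hx', hx''⟩ := hx
  obtain ⟨v, hv, hvx⟩ := hF'' i q _ hx''
  obtain ⟨z, hz⟩ := (F''.exact_succ i ((g.split (i + 1) x).2 - v)).1
    (by rw [map_sub, hvx, sub_self])
  have hconn : g.conn i (g.split (i + 1) x).2 = g.conn i v - F'.d i (g.conn (i + 1) z) := by
    rw [eq_sub_iff_add_eq, ← eq_sub_iff_add_eq', ← map_sub,
      ← neg_sub, map_neg, ← hz, ← add_eq_zero_iff_eq_neg]
    exact g.conn_succ i z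
  have key : F'.d i ((g.split (i + 1) x).1 - g.conn (i + 1) z) ∈
      𝔪 ^ (q + 1) • (⊤ : Submodule R (F'.X i)) := by
    have h1 : F'.d i ((g.split (i + 1) x).1 - g.conn (i + 1) z) =
        (F'.d i (g.split (i + 1) x).1 + g.conn i (g.split (i + 1) x).2) - g.conn i v := by
      rw [map_sub, hconn]
      abel
    rw [h1]
    exact sub_mem hx' (map_mem_pow_succ_smul_top 𝔪 (g.conn i) (hg i) hv)
  obtain ⟨w, hw, hwx⟩ := hF' i q _ key
  refine ⟨(g.split (i + 1)).symm (w, v), ?_, ?_⟩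
  · rw [mem_smul_top_iff]
    exact ⟨by simpa using hw, by simpa using hv⟩
  · apply (g.split i).injective
    rw [split_resolution_d, split_resolution_d, LinearEquiv.apply_symm_apply, hwx, hvx, hconn,
      map_sub]
    congr 1
    abel

end Gluing

end FreeResolution

/-- Families of additive subgroups `𝒜 j` of `R` and `ℳ j` of `M`, compatible with the products, and
additive projections onto their members. This covers gradings as well as the trivial
families `𝒜 j = R`, `ℳ j = M`. -/
structure HomogeneousProjections {R : Type u} [CommRing R] {M : Type u} [AddCommGroup M]
    [Module R M] (𝔪 : Ideal R) (𝒜 : ℤ → AddSubgroup R) (ℳ : ℤ → AddSubgroup M) where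
  mul_mem : ∀ {i j : ℤ} {x y : R}, x ∈ 𝒜 i → y ∈ 𝒜 j → x * y ∈ 𝒜 (i + j)
  smul_mem : ∀ {i j : ℤ} {x : R} {y : M}, x ∈ 𝒜 i → y ∈ ℳ j → x • y ∈ ℳ (i + j)
  /-- the projection of `R` onto `𝒜 j` -/
  proj : ℤ → R →+ R
  proj_mem : ∀ j x, proj j x ∈ 𝒜 j
  proj_of_mem : ∀ {j x}, x ∈ 𝒜 j → proj j x = x
  proj_mul : ∀ {n x} j y, x ∈ 𝒜 n → proj j (y * x) = proj (j - n) y * x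
  proj_mem_ideal : ∀ {x} j, x ∈ 𝔪 → proj j x ∈ 𝔪
  /-- the projection of `M` onto `ℳ j` -/
  projM : ℤ → M →+ M
  projM_of_mem : ∀ {j x}, x ∈ ℳ j → projM j x = x
  projM_smul : ∀ {n x} j (y : R), x ∈ ℳ n → projM j (y • x) = proj (j - n) y • x

/-- The degree `j` elements of the free module with basis elements of degrees `δ a`. -/
def freePiece {R : Type u} [CommRing R] (𝒜 : ℤ → AddSubgroup R) {n : ℕ} (δ : Fin n → ℤ) (j : ℤ) :
    AddSubgroup (Fin n → R) where
  carrier := {x | ∀ a, x a ∈ 𝒜 (j - δ a)}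
  add_mem' hx hy a := add_mem (hx a) (hy a)
  zero_mem' _ := zero_mem _
  neg_mem' hx a := neg_mem (hx a)

lemma mem_freePiece_iff {R : Type u} [CommRing R] {𝒜 : ℤ → AddSubgroup R} {n : ℕ} {δ : Fin n → ℤ}
    {j : ℤ} {x : Fin n → R} : x ∈ freePiece 𝒜 δ j ↔ ∀ a, x a ∈ 𝒜 (j - δ a) := Iff.rfl

/-! ### Homogeneous lifts -/

namespace HomogeneousProjections

variable {R : Type u} [CommRing R] {M : Type u} [AddCommGroup M] [Module R M] {𝔪 : Ideal R}
  {𝒜 : ℤ → AddSubgroup R} {ℳ : ℤ → AddSubgroup M} (H : HomogeneousProjections 𝔪 𝒜 ℳ)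
include H

lemma map_mem_of_mem_freePiece {n : ℕ} {δ : Fin n → ℤ} {f : (Fin n → R) →ₗ[R] R}
    (hf : ∀ a, f (Pi.single a 1) ∈ 𝒜 (δ a)) {j : ℤ} {x : Fin n → R} (hx : x ∈ freePiece 𝒜 δ j) :
    f x ∈ 𝒜 j := by
  rw [pi_linearMap_apply]
  refine sum_mem fun a _ => ?_
  have := H.mul_mem (hx a) (hf a)
  rwa [sub_add_cancel] at this

lemma map_mem_freePiece {n p : ℕ} {δ : Fin n → ℤ} {ε : Fin p → ℤ} {c : ℤ}
    {f : (Fin n → R) →ₗ[R] (Fin p → R)}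
    (hf : ∀ a, f (Pi.single a 1) ∈ freePiece 𝒜 ε (δ a + c)) {j : ℤ} {x : Fin n → R}
    (hx : x ∈ freePiece 𝒜 δ j) : f x ∈ freePiece 𝒜 ε (j + c) := by
  rw [pi_linearMap_apply]
  refine sum_mem fun a _ b => ?_
  have := H.mul_mem (hx a) (hf a b)
  rwa [show j - δ a + (δ a + c - ε b) = j + c - ε b by ring] at this

/-- A homogeneous element in the image of a homogeneous map has a homogeneous preimage. -/
lemma exists_mem_freePiece {n : ℕ} {δ : Fin n → ℤ} {f : (Fin n → R) →ₗ[R] M}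
    (hf : ∀ a, f (Pi.single a 1) ∈ ℳ (δ a)) {j : ℤ} {x : Fin n → R} (hx : f x ∈ ℳ j) :
    ∃ y ∈ freePiece 𝒜 δ j, f y = f x ∧ ((∀ a, x a ∈ 𝔪) → ∀ a, y a ∈ 𝔪) := by
  -- Each coordinate is replaced by its component of the complementary degree; as 𝔪 is stable under
  -- projections, membership in 𝔪 survives.
  refine ⟨fun a => H.proj (j - δ a) (x a), fun a => H.proj_mem _ _, ?_,
    fun h a => H.proj_mem_ideal _ (h a)⟩
  rw [← H.projM_of_mem hx, pi_linearMap_apply, pi_linearMap_apply f x, map_sum]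
  exact Finset.sum_congr rfl fun a _ => (H.projM_smul _ _ (hf a)).symm

lemma exists_mem_freePiece_pi {n p : ℕ} {δ : Fin n → ℤ} {ε : Fin p → ℤ}
    {f : (Fin n → R) →ₗ[R] (Fin p → R)}
    (hf : ∀ a, f (Pi.single a 1) ∈ freePiece 𝒜 ε (δ a)) {j : ℤ} {x : Fin n → R}
    (hx : f x ∈ freePiece 𝒜 ε j) :
    ∃ y ∈ freePiece 𝒜 δ j, f y = f x ∧ ((∀ a, x a ∈ 𝔪) → ∀ a, y a ∈ 𝔪) := by
  refine ⟨fun a => H.proj (j - δ a) (x a), fun a => H.proj_mem _ _, ?_,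
    fun h a => H.proj_mem_ideal _ (h a)⟩
  ext b
  rw [← H.proj_of_mem (hx b), pi_linearMap_apply, pi_linearMap_apply f x, Finset.sum_apply,
    Finset.sum_apply, map_sum]
  refine Finset.sum_congr rfl fun a _ => ?_
  rw [Pi.smul_apply, Pi.smul_apply, smul_eq_mul, smul_eq_mul, H.proj_mul _ _ (hf a b)]
  rw [show j - ε b - (δ a - ε b) = j - δ a by ring]

end HomogeneousProjections

/-! ### Connecting maps with values in 𝔪F' -/

namespace FreeResolution

/-- The basis vectors of `F i` have the degrees `deg i a`, and all the maps preserve degrees. -/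
structure IsGradedBy {R : Type u} [CommRing R] {N : Type u} [AddCommGroup N] [Module R N]
    (F : FreeResolution R N) (𝒜 : ℤ → AddSubgroup R) (𝒩 : ℤ → AddSubgroup N)
    (deg : ∀ i, Fin (F.rank i) → ℤ) : Prop where
  d_mem : ∀ i a, F.d i (Pi.single a 1) ∈ freePiece 𝒜 (deg i) (deg (i + 1) a)
  aug_mem : ∀ a, F.aug (Pi.single a 1) ∈ 𝒩 (deg 0 a)

variable {R : Type u} [CommRing R] {M : Type u} [AddCommGroup M] [Module R M] {𝔪 : Ideal R}
  {𝒜 : ℤ → AddSubgroup R} {ℳ : ℤ → AddSubgroup M}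

/-- Extending a cyclic quotient `R ⧸ I` by a submodule with a linear minimal resolution: the
connecting maps can be chosen with values in `𝔪 F'`. -/
lemma exists_gluing (H : HomogeneousProjections 𝔪 𝒜 ℳ) {N' N : Submodule R M} (hN' : N' ≤ N)
    {w : M} {c : ℤ} (hw : w ∈ N) (hwc : w ∈ ℳ c) (hN : ∀ n ∈ N, ∃ x ∈ N', ∃ r : R, x + r • w = n)
    {I : Ideal R} (hI : ∀ r, r ∈ I ↔ r • w ∈ N')
    (h𝔪 : ∀ (r : R) (h : r • w ∈ N'), (⟨r • w, h⟩ : N') ∈ 𝔪 • (⊤ : Submodule R N'))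
    {F' : FreeResolution R N'} {deg' : ∀ i, Fin (F'.rank i) → ℤ}
    (hF' : F'.IsLinear 𝔪) (hgr' : F'.IsGradedBy 𝒜 (subGrading ℳ N') deg')
    {F'' : FreeResolution R (R ⧸ I)} {deg'' : ∀ i, Fin (F''.rank i) → ℤ}
    (hF'' : F''.IsMinimal 𝔪)
    (hgr'' : F''.IsGradedBy 𝒜 (fun j => (𝒜 j).map (Submodule.mkQ I).toAddMonoidHom) deg'') :
    ∃ g : Gluing F' F'' N, (∀ i x, g.conn i x ∈ 𝔪 • (⊤ : Submodule R (F'.X i))) ∧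
      (∀ x, (g.incl x : M) = x) ∧ (∀ a, (g.lift (Pi.single a 1) : M) ∈ ℳ (deg'' 0 a + c)) ∧
      ∀ i a, g.conn i (Pi.single a 1) ∈ freePiece 𝒜 (deg' i) (deg'' (i + 1) a + c) := by
  -- ε lifts the augmentation of F'' to R, so x ↦ ε(x)w is the lift to N used for gluing.
  obtain ⟨ε, hε⟩ := exists_linearMap_pi (R := R)
    (fun a (y : R) => y ∈ 𝒜 (deg'' 0 a) ∧ Submodule.mkQ I y = F''.aug (Pi.single a 1))
    (fun a => hgr''.aug_mem a)
  have hεaug : ∀ x, Submodule.mkQ I (ε x) = F''.aug x := fun x =>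
    pi_linearMap_ext (f := Submodule.mkQ I ∘ₗ ε) (g := F''.aug) (fun a => (hε a).2) x
  have hεI : ∀ x, ε x ∈ I ↔ F''.aug x = 0 := fun x => by
    rw [← hεaug, Submodule.mkQ_apply, Submodule.Quotient.mk_eq_zero]
  have hεd : ∀ x, ε (F''.d 0 x) • w ∈ N' := fun x =>
    (hI _).1 ((hεI _).2 (F''.aug_d x))
  obtain ⟨φ₀, hφ₀⟩ := exists_linearMap_pi (R := R)
    (fun a (y : F'.X 0) => y ∈ 𝔪 • (⊤ : Submodule R (F'.X 0)) ∧
      y ∈ freePiece 𝒜 (deg' 0) (deg'' 1 a + c) ∧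
      (F'.aug y : M) + ε (F''.d 0 (Pi.single a 1)) • w = 0)
    (fun a => by
      -- ε(d''e_a)w lies in 𝔪N', which is the image of 𝔪F'_0; this gives the first connecting map
      -- its values in 𝔪F'_0.
      have h1 := h𝔪 _ (hεd (Pi.single a 1))
      have h2 : (⊤ : Submodule R N') = (⊤ : Submodule R (F'.X 0)).map F'.aug := by
        rw [Submodule.map_top, LinearMap.range_eq_top.2 F'.aug_surjective]
      rw [h2, ← Submodule.map_smul''] at h1
      obtain ⟨y, hy, hyw⟩ := h1
      have hyw' : (F'.aug y : M) = ε (F''.d 0 (Pi.single a 1)) • w := congrArg Subtype.val hyw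
      have h3 : N'.subtype.comp F'.aug y ∈ ℳ (deg'' 1 a + c) := by
        change (F'.aug y : M) ∈ _
        rw [hyw']
        exact H.smul_mem (H.map_mem_of_mem_freePiece (fun b => (hε b).1)
          (hgr''.d_mem 0 a)) hwc
      obtain ⟨z, hz, hzy, hz𝔪⟩ := H.exists_mem_freePiece (δ := deg' 0)
        (fun b => hgr'.aug_mem b) h3
      refine ⟨-z, neg_mem ?_, neg_mem hz, ?_⟩
      · exact (mem_smul_top_pi_iff 𝔪).2 (hz𝔪 ((mem_smul_top_pi_iff 𝔪).1 hy))
      · have hzy' : (F'.aug z : M) = F'.aug y := hzy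
        rw [map_neg, Submodule.coe_neg, hzy', hyw', neg_add_cancel])
  have hφ₀' : ∀ x, (F'.aug (φ₀ x) : M) + ε (F''.d 0 x) • w = 0 := fun x =>
    pi_linearMap_ext (f := N'.subtype ∘ₗ F'.aug ∘ₗ φ₀ +
      LinearMap.toSpanSingleton R M w ∘ₗ ε ∘ₗ F''.d 0) (g := 0) (fun a => (hφ₀ a).2.2) x
  obtain ⟨φ, hφ, hr, h0⟩ := exists_seq_of_step (A := fun i => F''.X (i + 1) →ₗ[R] F'.X i)
    (fun i φ => (∀ a, φ (Pi.single a 1) ∈ 𝔪 • (⊤ : Submodule R (F'.X i))) ∧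
      (∀ a, φ (Pi.single a 1) ∈ freePiece 𝒜 (deg' i) (deg'' (i + 1) a + c)) ∧
      ∀ x, ∃ y, F'.d i y = φ (F''.d (i + 1) x))
    (fun i φ ψ => ∀ x, F'.d i (ψ x) + φ (F''.d (i + 1) x) = 0) φ₀
    ⟨fun a => (hφ₀ a).1, fun a => (hφ₀ a).2.1, fun x => (F'.exact_zero _).1 (by
      have := hφ₀' (F''.d 1 x)
      rw [d_d, map_zero, zero_smul, add_zero] at this
      exact Subtype.ext this)⟩
    (fun i φ ⟨hφ1, hφ2, hφ3⟩ => by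
      obtain ⟨ψ, hψ⟩ := exists_linearMap_pi (R := R)
        (fun a (y : F'.X (i + 1)) => y ∈ 𝔪 • (⊤ : Submodule R (F'.X (i + 1))) ∧
          y ∈ freePiece 𝒜 (deg' (i + 1)) (deg'' (i + 2) a + c) ∧
          F'.d i y + φ (F''.d (i + 1) (Pi.single a 1)) = 0)
        (fun a => by
          obtain ⟨y₀, hy₀⟩ := hφ3 (Pi.single a 1)
          -- The decisive use of linearity: φ and d'' each contribute a factor 𝔪, and strictness of
          -- F' trades membership in 𝔪² for a preimage in 𝔪F'.
          have h1 : F'.d i y₀ ∈ 𝔪 ^ (1 + 1) • (⊤ : Submodule R (F'.X i)) := by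
            rw [hy₀]
            refine map_mem_pow_succ_smul_top 𝔪 φ (map_mem_of_forall_single φ _ hφ1) ?_
            rw [pow_one]
            exact hF''.d_mem _ _
          obtain ⟨y, hy, hyy₀⟩ := hF' i 1 y₀ h1
          rw [pow_one] at hy
          have h2 : F'.d i y ∈ freePiece 𝒜 (deg' i) (deg'' (i + 2) a + c) := by
            rw [hyy₀, hy₀]
            exact H.map_mem_freePiece hφ2 (hgr''.d_mem (i + 1) a)
          obtain ⟨z, hz, hzy, hz𝔪⟩ := H.exists_mem_freePiece_pi (hgr'.d_mem i) h2
          refine ⟨-z, neg_mem ?_, neg_mem hz, ?_⟩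
          · exact (mem_smul_top_pi_iff 𝔪).2 (hz𝔪 ((mem_smul_top_pi_iff 𝔪).1 hy))
          · rw [map_neg, hzy, hyy₀, hy₀, neg_add_cancel])
      have hd : ∀ x, F'.d i (ψ x) + φ (F''.d (i + 1) x) = 0 := fun x =>
        pi_linearMap_ext (f := F'.d i ∘ₗ ψ + φ ∘ₗ F''.d (i + 1)) (g := 0) (fun a => (hψ a).2.2) x
      refine ⟨ψ, ⟨fun a => (hψ a).1, fun a => (hψ a).2.1, fun x => ?_⟩, hd⟩
      refine (F'.exact_succ i _).1 ?_
      have := hd (F''.d (i + 2) x)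
      rwa [d_d, map_zero, add_zero] at this)
  refine ⟨{
    incl := Submodule.inclusion hN'
    lift := LinearMap.toSpanSingleton R N ⟨w, hw⟩ ∘ₗ ε
    conn := φ
    incl_injective := Submodule.inclusion_injective hN'
    exists_eq := ?_
    aug_eq_zero := ?_
    conn_zero := ?_
    conn_succ := hr }, fun i => map_mem_of_forall_single _ _ (hφ i).1, fun x => rfl, fun a => ?_,
    fun i => (hφ i).2.1⟩
  · rintro ⟨n, hn⟩
    obtain ⟨x, hx, r, rfl⟩ := hN n hn
    obtain ⟨y, hy⟩ := F''.aug_surjective (Submodule.mkQ I r)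
    rw [← hεaug, eq_comm, ← sub_eq_zero, ← map_sub, Submodule.mkQ_apply,
      Submodule.Quotient.mk_eq_zero, hI] at hy
    -- As `y` lifts the class of r, the difference r - ε(y) lies in I, so its product with w can be
    -- moved into N'.
    refine ⟨⟨x + (r - ε y) • w, add_mem hx hy⟩, y, Subtype.ext ?_⟩
    change x + (r - ε y) • w + ε y • w = x + r • w
    rw [sub_smul]
    abel
  · intro x y hxy
    have h1 : (x : M) + ε y • w = 0 := congrArg Subtype.val hxy
    rw [← hεI, hI, eq_neg_of_add_eq_zero_right h1]
    exact neg_mem x.2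
  · intro x
    apply Subtype.ext
    rw [h0]
    exact hφ₀' x
  · exact H.smul_mem (hε a).1 hwc

end FreeResolution

/-- The number of basis elements of degree `j`. -/
def degCount {n : ℕ} (δ : Fin n → ℤ) (j : ℤ) : ℕ := ∑ a, if δ a = j then 1 else 0

/-- The degrees of the basis elements of a direct sum, the second summand being shifted by `c`. -/
def appendDeg {n p : ℕ} (δ : Fin n → ℤ) (ε : Fin p → ℤ) (c : ℤ) : Fin (n + p) → ℤ :=
  Fin.addCases δ (fun a => ε a + c)

lemma degCount_appendDeg {n p : ℕ} (δ : Fin n → ℤ) (ε : Fin p → ℤ) (c j : ℤ) :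
    degCount (appendDeg δ ε c) j = degCount δ j + degCount ε (j - c) := by
  simp only [degCount, appendDeg, Fin.sum_univ_add, Fin.addCases_left, Fin.addCases_right,
    eq_sub_iff_add_eq]

lemma mem_freePiece_appendDeg_iff {R : Type u} [CommRing R] {𝒜 : ℤ → AddSubgroup R} {n p : ℕ}
    {δ : Fin n → ℤ} {ε : Fin p → ℤ} {c j : ℤ} {x : Fin (n + p) → R} :
    x ∈ freePiece 𝒜 (appendDeg δ ε c) j ↔ (splitEquiv R n p x).1 ∈ freePiece 𝒜 δ j ∧
      (splitEquiv R n p x).2 ∈ freePiece 𝒜 ε (j - c) := by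
  simp only [mem_freePiece_iff, splitEquiv_fst, splitEquiv_snd]
  constructor
  · refine fun h => ⟨fun a => ?_, fun a => ?_⟩
    · have := h (Fin.castAdd p a)
      rwa [appendDeg, Fin.addCases_left] at this
    · have := h (Fin.natAdd n a)
      rwa [appendDeg, Fin.addCases_right, add_comm, ← sub_sub] at this
  · rintro ⟨h, h'⟩ a
    refine Fin.addCases (fun a => ?_) (fun a => ?_) a
    · rw [appendDeg, Fin.addCases_left]
      exact h a
    · rw [appendDeg, Fin.addCases_right, add_comm, ← sub_sub]
      exact h' a

/-! ### Degrees in the glued resolution -/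

namespace FreeResolution

variable {R : Type u} [CommRing R]

lemma Gluing.isGradedBy {N N' N'' : Type u} [AddCommGroup N] [Module R N]
    [AddCommGroup N'] [Module R N'] [AddCommGroup N''] [Module R N''] {𝒜 : ℤ → AddSubgroup R}
    {𝒩 : ℤ → AddSubgroup N} {𝒩' : ℤ → AddSubgroup N'} {𝒩'' : ℤ → AddSubgroup N''}
    {F' : FreeResolution R N'} {F'' : FreeResolution R N''} (g : Gluing F' F'' N) {c : ℤ}
    {deg' : ∀ i, Fin (F'.rank i) → ℤ} (hF' : F'.IsGradedBy 𝒜 𝒩' deg')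
    {deg'' : ∀ i, Fin (F''.rank i) → ℤ} (hF'' : F''.IsGradedBy 𝒜 𝒩'' deg'')
    (hincl : ∀ {j x}, x ∈ 𝒩' j → g.incl x ∈ 𝒩 j)
    (hlift : ∀ a, g.lift (Pi.single a 1) ∈ 𝒩 (deg'' 0 a + c))
    (hconn : ∀ i a, g.conn i (Pi.single a 1) ∈ freePiece 𝒜 (deg' i) (deg'' (i + 1) a + c)) :
    g.resolution.IsGradedBy 𝒜 𝒩 (fun i => appendDeg (deg' i) (deg'' i) c) := by
  have hd : ∀ i a, g.d i (Pi.single a 1) ∈ freePiece 𝒜 (appendDeg (deg' i) (deg'' i) c)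
      (appendDeg (deg' (i + 1)) (deg'' (i + 1)) c a) := fun i a => by
    rw [mem_freePiece_appendDeg_iff, split_d]
    refine Fin.addCases (fun b => ?_) (fun b => ?_) a
    · rw [splitEquiv_single_castAdd, appendDeg, Fin.addCases_left]
      simp only [map_zero, add_zero]
      exact ⟨hF'.d_mem i b, zero_mem _⟩
    · rw [splitEquiv_single_natAdd, appendDeg, Fin.addCases_right, add_sub_cancel_right]
      simp only [map_zero, zero_add]
      exact ⟨hconn i b, hF''.d_mem i b⟩
  have haug : ∀ a, g.aug (Pi.single a 1) ∈ 𝒩 (appendDeg (deg' 0) (deg'' 0) c a) := fun a => by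
    rw [aug_apply]
    refine Fin.addCases (fun b => ?_) (fun b => ?_) a
    · rw [splitEquiv_single_castAdd, appendDeg, Fin.addCases_left]
      simp only [map_zero, add_zero]
      exact hincl (hF'.aug_mem b)
    · rw [splitEquiv_single_natAdd, appendDeg, Fin.addCases_right]
      simp only [map_zero, zero_add]
      exact hlift b
  exact ⟨hd, haug⟩

/-- The zero resolution of the zero module. -/
def zero (R : Type u) [CommRing R] (N : Type u) [AddCommGroup N] [Module R N] [Subsingleton N] :
    FreeResolution R N where
  rank _ := 0
  d _ := 0
  aug := 0
  aug_surjective _ := ⟨0, Subsingleton.elim _ _⟩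
  exact_zero _ := ⟨fun _ => ⟨0, Subsingleton.elim _ _⟩, fun _ => rfl⟩
  exact_succ _ _ := ⟨fun _ => ⟨0, Subsingleton.elim _ _⟩, fun _ => rfl⟩

end FreeResolution

/-! ### Colon ideals and induction along the generators -/

section Colon

variable {R : Type u} [CommRing R] {M : Type u} [AddCommGroup M] [Module R M] {t : ℕ}
  {m : Fin t → M} {𝔪 : Ideal R}

lemma mem_colonIdeal_iff {l : Fin t} {r : R} :
    r ∈ colonIdeal R m l ↔ r • m l ∈ initial R m l :=
  Submodule.mem_colon_singleton

lemma initial_mono {i j : ℕ} (h : i ≤ j) : initial R m i ≤ initial R m j :=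
  Submodule.span_mono (Set.image_mono fun _ ha => lt_of_lt_of_le ha h)

lemma mem_initial_of_lt {i : ℕ} {l : Fin t} (h : (l : ℕ) < i) : m l ∈ initial R m i :=
  Submodule.subset_span ⟨l, h, rfl⟩

lemma initial_zero : initial R m 0 = ⊥ := by
  simp [initial]

lemma initial_self : initial R m t = Submodule.span R (Set.range m) := by
  rw [initial, ← Set.image_univ]
  congr 2
  ext l
  simp

lemma initial_succ (l : Fin t) :
    initial R m (l + 1) = initial R m l ⊔ Submodule.span R {m l} := by
  rw [initial, initial, ← Submodule.span_union, ← Set.image_singleton, ← Set.image_union]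
  congr 2
  ext j
  simp [Fin.ext_iff]
  omega

/-- The elements of `initial R m i` are the linear combinations of the first `i` generators. -/
lemma exists_sum_eq_of_mem_initial {i : ℕ} {x : M} (hx : x ∈ initial R m i) :
    ∃ b : Fin t → R, (∀ j : Fin t, i ≤ j → b j = 0) ∧ ∑ j, b j • m j = x := by
  rw [initial] at hx
  induction hx using Submodule.span_induction with
  | mem x hx =>
    obtain ⟨l, hl, rfl⟩ := hx
    refine ⟨Pi.single l 1, fun j hj => Pi.single_eq_of_ne ?_ _, ?_⟩
    · rintro rfl
      exact absurd hl (not_lt.2 hj)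
    · simp [Pi.single_apply, ite_smul]
  | zero => exact ⟨0, fun _ _ => rfl, by simp⟩
  | add x y _ _ hx hy =>
    obtain ⟨b, hb, rfl⟩ := hx
    obtain ⟨c, hc, rfl⟩ := hy
    exact ⟨b + c, fun j hj => by simp [hb j hj, hc j hj], by
      simp [add_smul, Finset.sum_add_distrib]⟩
  | smul r x _ hx =>
    obtain ⟨b, hb, rfl⟩ := hx
    exact ⟨r • b, fun j hj => by simp [hb j hj], by simp [Finset.smul_sum, mul_smul]⟩

/-- If all the relations among the generators have coefficients in `𝔪`, then
`I_l m_l ⊆ 𝔪 (m_1, …, m_{l-1})`. -/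
lemma smul_mem_smul_top_initial (hrel : ∀ b : Fin t → R, ∑ j, b j • m j = 0 → ∀ j, b j ∈ 𝔪)
    (l : Fin t) (r : R) (h : r • m l ∈ initial R m l) :
    (⟨r • m l, h⟩ : initial R m l) ∈ 𝔪 • (⊤ : Submodule R (initial R m l)) := by
  obtain ⟨b, hb, hbx⟩ := exists_sum_eq_of_mem_initial h
  -- Writing r m_l through earlier generators is a relation with coefficient -r at l, so the other
  -- coefficients lie in 𝔪.
  have hrel' := hrel (b - Pi.single l r) (by
    simp [sub_smul, Finset.sum_sub_distrib, hbx, Pi.single_apply, ite_smul])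
  have hsum : (⟨r • m l, h⟩ : initial R m l) =
      ∑ j, b j • (if hj : j < l then ⟨m j, mem_initial_of_lt hj⟩ else 0) := by
    apply Subtype.ext
    rw [AddSubmonoidClass.coe_finsetSum]
    refine hbx.symm.trans ?_
    refine Finset.sum_congr rfl fun j _ => ?_
    split_ifs with hj
    · rfl
    · simp [hb j (not_lt.1 hj)]
  rw [hsum]
  refine sum_mem fun j _ => ?_
  rcases lt_or_ge j l with hj | hj
  · have := hrel' j
    rw [Pi.sub_apply, Pi.single_eq_of_ne hj.ne, sub_zero] at this
    exact Submodule.smul_mem_smul this trivial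
  · rw [hb j hj, zero_smul]
    exact zero_mem _

/-- Otherwise m_l would be a combination of its predecessors, a relation with coefficient -1. This
makes each R/I_l nonzero, as the comparison of projective dimensions requires. -/
lemma colonIdeal_ne_top (h𝔪 : 𝔪 ≠ ⊤)
    (hrel : ∀ b : Fin t → R, ∑ j, b j • m j = 0 → ∀ j, b j ∈ 𝔪) (l : Fin t) :
    colonIdeal R m l ≠ ⊤ := by
  intro h
  have h1 : (1 : R) ∈ colonIdeal R m l := h ▸ trivial
  rw [mem_colonIdeal_iff] at h1
  obtain ⟨b, hb, hbx⟩ := exists_sum_eq_of_mem_initial h1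
  have := hrel (b - Pi.single l 1) (by
    simp [sub_smul, Finset.sum_sub_distrib, hbx, Pi.single_apply, ite_smul]) l
  rw [Pi.sub_apply, Pi.single_eq_same, hb l le_rfl, zero_sub, neg_mem_iff] at this
  exact h𝔪 ((Ideal.eq_top_iff_one 𝔪).2 this)

lemma sum_filter_lt_succ (l : Fin t) (f : Fin t → ℕ) :
    ∑ j ∈ ({j | (j : ℕ) < l + 1} : Finset (Fin t)), f j =
      ∑ j ∈ ({j | (j : ℕ) < l} : Finset (Fin t)), f j + f l := by
  have : Finset.univ.filter (fun j : Fin t => (j : ℕ) < l + 1) =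
      insert l (Finset.univ.filter fun j : Fin t => (j : ℕ) < l) := by
    ext j
    simp [Fin.ext_iff]
    omega
  rw [this, Finset.sum_insert (by simp), add_comm]

open FreeResolution in
/-- Linear minimal resolutions of the submodules generated by initial segments of `m`, glued from
linear minimal resolutions of the successive quotients. -/
theorem exists_linear_resolution_initial {𝒜 : ℤ → AddSubgroup R} {ℳ : ℤ → AddSubgroup M}
    (H : HomogeneousProjections 𝔪 𝒜 ℳ) {d : Fin t → ℤ} (hm : ∀ l, m l ∈ ℳ (d l))
    (hrel : ∀ b : Fin t → R, ∑ j, b j • m j = 0 → ∀ j, b j ∈ 𝔪)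
    {G : ∀ l, FreeResolution R (R ⧸ colonIdeal R m l)} {δ : ∀ l i, Fin ((G l).rank i) → ℤ}
    (hmin : ∀ l, (G l).IsMinimal 𝔪) (hlin : ∀ l, (G l).IsLinear 𝔪)
    (hgr : ∀ l, (G l).IsGradedBy 𝒜
      (fun j => (𝒜 j).map (Submodule.mkQ (colonIdeal R m l)).toAddMonoidHom) (δ l))
    (i : ℕ) (hi : i ≤ t) :
    ∃ (F : FreeResolution R (initial R m i)) (deg : ∀ i, Fin (F.rank i) → ℤ),
      F.IsMinimal 𝔪 ∧ F.IsLinear 𝔪 ∧ F.IsGradedBy 𝒜 (subGrading ℳ (initial R m i)) deg ∧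
      (∀ s, F.rank s = ∑ l ∈ ({l | (l : ℕ) < i} : Finset (Fin t)), (G l).rank s) ∧
      ∀ s j, degCount (deg s) j = 
        ∑ l ∈ ({l | (l : ℕ) < i} : Finset (Fin t)), degCount (δ l s) (j - d l) := by
  induction i with
  -- Starting from the zero module, rather than (m_1), treats R/I_1 like every other quotient.
  | zero =>
    have : Subsingleton (initial R m 0) := by rw [initial_zero]; infer_instance
    refine ⟨FreeResolution.zero R _, fun _ a => a.elim0, fun i => ?_, fun i q x _ => ?_,
      ⟨fun i a => a.elim0, fun a => a.elim0⟩, fun s => ?_, fun s j => ?_⟩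
    · rintro _ ⟨x, rfl⟩
      exact zero_mem _
    · exact ⟨0, zero_mem _, rfl⟩
    · simp [FreeResolution.zero]
    · simp [degCount, FreeResolution.zero]
  | succ i ih =>
    obtain ⟨F, deg, hFmin, hFlin, hFgr, hrank, hcount⟩ := ih (by omega)
    let l : Fin t := ⟨i, hi⟩
    obtain ⟨g, hg𝔪, hgincl, hglift, hgconn⟩ := exists_gluing H
      (N' := initial R m i) (N := initial R m (i + 1)) (w := m l) (c := d l) (I := colonIdeal R m l)
      (initial_mono (Nat.le_succ i)) (mem_initial_of_lt (Nat.lt_succ_self i)) (hm l)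
      (fun n hn => by
        have h1 : initial R m (i + 1) = _ := initial_succ l
        rw [h1, Submodule.mem_sup] at hn
        obtain ⟨x, hx, y, hy, rfl⟩ := hn
        obtain ⟨r, rfl⟩ := Submodule.mem_span_singleton.1 hy
        exact ⟨x, hx, r, rfl⟩)
      (fun r => mem_colonIdeal_iff) (smul_mem_smul_top_initial hrel l) hFlin hFgr (hmin l) (hgr l)
    refine ⟨g.resolution, fun s => appendDeg (deg s) (δ l s) (d l), g.isMinimal hFmin (hmin l) hg𝔪,
      g.isLinear hFlin (hlin l) hg𝔪, ?_, fun s => ?_, fun s j => ?_⟩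
    · refine g.isGradedBy hFgr (hgr l) (fun {j x} hx => ?_) hglift hgconn
      change (g.incl x : M) ∈ ℳ j
      rw [hgincl]
      exact hx
    · exact (congrArg (· + (G l).rank s) (hrank s)).trans (sum_filter_lt_succ l _).symm
    · refine (degCount_appendDeg _ _ _ _).trans ?_
      rw [hcount]
      exact (sum_filter_lt_succ l _).symm

end Colon

/-! ### The maximal ideal and projections of a standard graded algebra -/

section StandardGraded

variable {k : Type v} [Field k] {R : Type u} [CommRing R] [Algebra k R]
  {𝒜 : ℤ → Submodule k R} [GradedAlgebra 𝒜]

/-- Without negative degrees, only degree-zero parts contribute to the degree-zero part of a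
product. This multiplicativity identifies 𝔪 with the kernel of the projection to degree 0. -/
lemma IsStandardGraded.proj_zero_mul (h : IsStandardGraded 𝒜) (x y : R) :
    GradedRing.proj 𝒜 0 (x * y) = GradedRing.proj 𝒜 0 x * GradedRing.proj 𝒜 0 y := by
  have hneg : ∀ n < 0, ∀ z ∈ 𝒜 n, z = 0 := fun n hn z hz => by
    rwa [h.neg n hn, Submodule.mem_bot] at hz
  induction y using DirectSum.Decomposition.inductionOn 𝒜 with
  | zero => simp
  | @homogeneous n y =>
    have h1 := DirectSum.coe_decompose_mul_add_of_right_mem 𝒜 (i := -n) (a := x) y.2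
    rw [neg_add_cancel] at h1
    rw [GradedRing.proj_apply, h1]
    rcases lt_trichotomy n 0 with hn | rfl | hn
    · rw [hneg n hn y y.2, mul_zero, map_zero, mul_zero]
    · rw [GradedRing.proj_apply, GradedRing.proj_apply, DirectSum.decompose_of_mem_same 𝒜 y.2,
        neg_zero]
    · rw [hneg (-n) (by omega) _ (SetLike.coe_mem _), zero_mul, GradedRing.proj_apply 𝒜 0 (y : R),
        DirectSum.decompose_of_mem_ne 𝒜 y.2 hn.ne', mul_zero]
  | add y z hy hz => rw [mul_add, map_add, map_add, hy, hz, mul_add]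

lemma IsStandardGraded.mem_gradedMaximalIdeal_iff (h : IsStandardGraded 𝒜) {x : R} :
    x ∈ gradedMaximalIdeal 𝒜 ↔ GradedRing.proj 𝒜 0 x = 0 := by
  classical
  constructor
  · intro hx
    refine Submodule.span_induction ?_ ?_ ?_ ?_ hx
    · rintro y ⟨n, hn, hy⟩
      rw [GradedRing.proj_apply, DirectSum.decompose_of_mem_ne 𝒜 hy hn.ne']
    · exact map_zero _
    · intro y z _ _ hy hz
      rw [map_add, hy, hz, add_zero]
    · intro r y _ hy
      rw [smul_eq_mul, h.proj_zero_mul, hy, mul_zero]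
  · intro hx
    rw [← DirectSum.sum_support_decompose 𝒜 x]
    refine sum_mem fun n _ => ?_
    rcases lt_trichotomy n 0 with hn | rfl | hn
    · have h0 : ∀ z ∈ 𝒜 n, z = 0 := fun z hz => by rwa [h.neg n hn, Submodule.mem_bot] at hz
      rw [h0 _ (SetLike.coe_mem _)]
      exact zero_mem _
    · rw [GradedRing.proj_apply] at hx
      rw [hx]
      exact zero_mem _
    · exact Ideal.subset_span ⟨n, hn, SetLike.coe_mem _⟩

lemma IsStandardGraded.gradedMaximalIdeal_ne_top (h : IsStandardGraded 𝒜) :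
    gradedMaximalIdeal 𝒜 ≠ ⊤ := by
  have := h.nontrivial
  rw [Ne, Ideal.eq_top_iff_one, h.mem_gradedMaximalIdeal_iff, GradedRing.proj_apply,
    DirectSum.decompose_of_mem_same 𝒜 SetLike.GradedOne.one_mem]
  exact one_ne_zero

lemma IsStandardGraded.eq_zero_of_algebraMap_mem (h : IsStandardGraded 𝒜) {c : k}
    (hc : algebraMap k R c ∈ gradedMaximalIdeal 𝒜) : c = 0 := by
  by_contra h0
  exact h.gradedMaximalIdeal_ne_top
    (Ideal.eq_top_of_isUnit_mem _ hc ((isUnit_iff_ne_zero.2 h0).map (algebraMap k R)))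

lemma IsStandardGraded.mem_gradedMaximalIdeal_of_mem (h : IsStandardGraded 𝒜) {x : R} {n : ℤ}
    (hx : x ∈ 𝒜 n) (hn : n ≠ 0) : x ∈ gradedMaximalIdeal 𝒜 := by
  rw [h.mem_gradedMaximalIdeal_iff, GradedRing.proj_apply, DirectSum.decompose_of_mem_ne 𝒜 hx hn]

/-- The graded substitute for locality: an element outside 𝔪 need not be a unit, but its degree-zero
component is a nonzero scalar. -/
lemma IsStandardGraded.isUnit_proj_zero (h : IsStandardGraded 𝒜) {x : R}
    (hx : x ∉ gradedMaximalIdeal 𝒜) : IsUnit (GradedRing.proj 𝒜 0 x) := by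
  rw [h.mem_gradedMaximalIdeal_iff] at hx
  obtain ⟨c, hc⟩ := h.zero (GradedRing.proj 𝒜 0 x) (SetLike.coe_mem _)
  rw [← hc] at hx ⊢
  refine (isUnit_iff_ne_zero.2 fun h0 => hx ?_).map _
  rw [h0, map_zero]

lemma proj_smul_of_mem {M : Type u} [AddCommGroup M] [Module R M] {ℳ : ℤ → AddSubgroup M}
    [DirectSum.Decomposition ℳ] [SetLike.GradedSMul 𝒜 ℳ] {n : ℤ} {x : M} (hx : x ∈ ℳ n) (j : ℤ)
    (r : R) : (DirectSum.decompose ℳ (r • x) j : M) = GradedRing.proj 𝒜 (j - n) r • x := by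
  induction r using DirectSum.Decomposition.inductionOn 𝒜 with
  | zero => simp
  | @homogeneous i r =>
    have h1 : (r : R) • x ∈ ℳ (i + n) := SetLike.GradedSMul.smul_mem r.2 hx
    rw [GradedRing.proj_apply]
    by_cases hj : i + n = j
    · subst hj
      rw [DirectSum.decompose_of_mem_same ℳ h1, add_sub_cancel_right,
        DirectSum.decompose_of_mem_same 𝒜 r.2]
    · rw [DirectSum.decompose_of_mem_ne ℳ h1 hj, DirectSum.decompose_of_mem_ne 𝒜 r.2 (by omega),
        zero_smul]
  | add r s hr hs =>
    rw [add_smul, DirectSum.decompose_add, DirectSum.add_apply, AddSubgroup.coe_add, hr, hs,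
      map_add, add_smul]

/-- The projections onto the homogeneous components of a graded module. -/
def IsStandardGraded.projections (h : IsStandardGraded 𝒜) {M : Type u} [AddCommGroup M]
    [Module R M] (ℳ : ℤ → AddSubgroup M) [DirectSum.Decomposition ℳ] [SetLike.GradedSMul 𝒜 ℳ] :
    HomogeneousProjections (gradedMaximalIdeal 𝒜) (fun j => (𝒜 j).toAddSubgroup) ℳ where
  mul_mem hx hy := SetLike.GradedMul.mul_mem (A := 𝒜) hx hy
  smul_mem hx hy := SetLike.GradedSMul.smul_mem (A := 𝒜) hx hy
  proj := GradedRing.proj 𝒜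
  proj_mem _ _ := SetLike.coe_mem _
  proj_of_mem hx := DirectSum.decompose_of_mem_same 𝒜 hx
  proj_mul {n x} j y hx := by
    have := DirectSum.coe_decompose_mul_add_of_right_mem 𝒜 (i := j - n) (a := y) hx
    rwa [sub_add_cancel] at this
  proj_mem_ideal {x} j hx := by
    rw [h.mem_gradedMaximalIdeal_iff] at hx ⊢
    by_cases hj : j = 0
    · rw [hj, hx, map_zero]
    · rw [GradedRing.proj_apply, GradedRing.proj_apply,
        DirectSum.decompose_of_mem_ne 𝒜 (SetLike.coe_mem _) hj]
  projM j := AddMonoidHom.mk' (fun x => (DirectSum.decompose ℳ x j : M)) fun x y => by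
    rw [DirectSum.decompose_add, DirectSum.add_apply, AddSubgroup.coe_add]
  projM_of_mem hx := DirectSum.decompose_of_mem_same ℳ hx
  projM_smul j y hx := proj_smul_of_mem hx j y

end StandardGraded

/-- The projections induced on the quotient by a homogeneous ideal. -/
def HomogeneousProjections.quotient {R : Type u} [CommRing R] {M : Type u} [AddCommGroup M]
    [Module R M] {𝔪 : Ideal R} {𝒜 : ℤ → AddSubgroup R} {ℳ : ℤ → AddSubgroup M}
    (H : HomogeneousProjections 𝔪 𝒜 ℳ) (I : Ideal R) (hI : ∀ j, ∀ x ∈ I, H.proj j x ∈ I) :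
    HomogeneousProjections 𝔪 𝒜 (fun j => (𝒜 j).map (Submodule.mkQ I).toAddMonoidHom) where
  mul_mem := H.mul_mem
  smul_mem {i j x y} hx hy := by
    obtain ⟨y, hy, rfl⟩ := hy
    exact ⟨x * y, H.mul_mem hx hy, rfl⟩
  proj := H.proj
  proj_mem := H.proj_mem
  proj_of_mem := H.proj_of_mem
  proj_mul := H.proj_mul
  proj_mem_ideal := H.proj_mem_ideal
  projM j := QuotientAddGroup.lift I.toAddSubgroup
    ((Submodule.mkQ I).toAddMonoidHom.comp (H.proj j)) fun x hx =>
      (Submodule.Quotient.mk_eq_zero I).2 (hI j x hx)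
  projM_of_mem {j x} hx := by
    obtain ⟨y, hy, rfl⟩ := hx
    exact congrArg (Submodule.mkQ I) (H.proj_of_mem hy)
  projM_smul {n x} j r hx := by
    obtain ⟨y, hy, rfl⟩ := hx
    exact congrArg (Submodule.mkQ I) (H.proj_mul j r hy)

/-! ### Graded Betti numbers from minimal resolutions -/

namespace GradedFreeResolution

variable {k : Type v} [Field k] {R : Type u} [CommRing R] [Algebra k R]
  {𝒜 : ℤ → Submodule k R} {M : Type u} [AddCommGroup M] [Module R M]
  {ℳ : ℤ → AddSubgroup M}

/-- The graded free resolution with the degrees `deg`. -/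
def ofIsGradedBy (F : FreeResolution R M) {deg : ∀ i, Fin (F.rank i) → ℤ}
    (h : F.IsGradedBy (fun j => (𝒜 j).toAddSubgroup) ℳ deg) : GradedFreeResolution 𝒜 ℳ where
  toFreeResolution := F
  deg := deg
  d_mem i a b := h.d_mem i a b
  aug_mem := h.aug_mem

lemma isGradedBy (F : GradedFreeResolution 𝒜 ℳ) :
    F.toFreeResolution.IsGradedBy (fun j => (𝒜 j).toAddSubgroup) ℳ F.deg :=
  ⟨F.d_mem, F.aug_mem⟩

lemma mem_maxPart_iff (F : GradedFreeResolution 𝒜 ℳ) {i : ℕ} {x : F.X i} :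
    x ∈ F.maxPart i ↔ ∀ a, x a ∈ gradedMaximalIdeal 𝒜 :=
  mem_smul_top_pi_iff _

variable [GradedAlgebra 𝒜]

/-- The linear combinations of the basis vectors of degree `j`. -/
def degreePart (F : GradedFreeResolution 𝒜 ℳ) (i : ℕ) (j : ℤ) :
    ({a // F.deg i a = j} → k) →ₗ[k] F.piece i j where
  toFun c := ⟨fun a => if h : F.deg i a = j then algebraMap k R (c ⟨a, h⟩) else 0, fun a => by
    dsimp only
    split_ifs with h
    · rw [h, sub_self]
      exact SetLike.algebraMap_mem_graded 𝒜 _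
    · exact zero_mem _⟩
  map_add' c c' := by
    ext a
    by_cases h : F.deg i a = j <;> simp [h]
  map_smul' r c := by
    ext a
    by_cases h : F.deg i a = j <;> simp [h, Algebra.smul_def]

lemma card_eq_degCount {n : ℕ} (δ : Fin n → ℤ) (j : ℤ) :
    Fintype.card {a // δ a = j} = degCount δ j := by
  rw [Fintype.card_subtype, Finset.card_filter, degCount]

/-- The coordinate at a of a degree j vector has degree j - deg a: it is a scalar when this is 0,
and vanishes modulo 𝔪 otherwise. -/
lemma mkQ_degreePart_surjective (h𝒜 : IsStandardGraded 𝒜) (F : GradedFreeResolution 𝒜 ℳ) (i : ℕ)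
    (j : ℤ) : Function.Surjective
      (((F.maxPart i).submoduleOf (F.piece i j)).mkQ ∘ₗ F.degreePart i j) := by
  intro z
  obtain ⟨⟨x, hx⟩, rfl⟩ := Submodule.Quotient.mk_surjective _ z
  have hc : ∀ a : {a // F.deg i a = j}, ∃ c : k, algebraMap k R c = x a := fun a =>
    h𝒜.zero _ (by have := hx a; rwa [a.2, sub_self] at this)
  choose c hc using hc
  refine ⟨c, (Submodule.Quotient.eq _).2 ?_⟩
  refine (mem_maxPart_iff F).2 fun a => ?_
  change (if h : F.deg i a = j then algebraMap k R (c ⟨a, h⟩) else 0) - x a ∈ _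
  split_ifs with h
  · rw [hc, sub_self]
    exact zero_mem _
  · rw [zero_sub, neg_mem_iff]
    exact h𝒜.mem_gradedMaximalIdeal_of_mem (hx a) (sub_ne_zero.2 (Ne.symm h))

lemma finite_red (h𝒜 : IsStandardGraded 𝒜) (F : GradedFreeResolution 𝒜 ℳ) (i : ℕ) (j : ℤ) :
    Module.Finite k (F.red i j) :=
  Module.Finite.of_surjective _ (F.mkQ_degreePart_surjective h𝒜 i j)

lemma finite_tor (h𝒜 : IsStandardGraded 𝒜) (F : GradedFreeResolution 𝒜 ℳ) (i : ℕ) (j : ℤ) :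
    Module.Finite k (F.tor i j) :=
  have := F.finite_red h𝒜 i j
  inferInstance

/-- Tor is a subquotient of the degree j part of F/𝔪F, which the basis vectors of degree j span. -/
lemma finrank_tor_le (h𝒜 : IsStandardGraded 𝒜) (F : GradedFreeResolution 𝒜 ℳ) (i : ℕ) (j : ℤ) :
    Module.finrank k (F.tor i j) ≤ degCount (F.deg i) j := by
  have := F.finite_red h𝒜 i j
  refine (Submodule.finrank_quotient_le _).trans ((Submodule.finrank_le _).trans ?_)
  refine (LinearMap.finrank_le_finrank_of_surjective (F.mkQ_degreePart_surjective h𝒜 i j)).trans ?_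
  rw [Module.finrank_fintype_fun_eq_card, card_eq_degCount]

/-- A lower bound for the dimension of `Tor`, computed from any resolution. -/
lemma degCount_le_finrank_tor (h𝒜 : IsStandardGraded 𝒜)
    (H : HomogeneousProjections (gradedMaximalIdeal 𝒜) (fun j => (𝒜 j).toAddSubgroup) ℳ)
    (F G : GradedFreeResolution 𝒜 ℳ) (hF : F.IsMinimal (gradedMaximalIdeal 𝒜)) (i : ℕ) (j : ℤ) :
    degCount (F.deg i) j ≤ Module.finrank k (G.tor i j) := by
  obtain ⟨α, hαQ, hα₀, hα⟩ := F.toFreeResolution.exists_comparison G.toFreeResolution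
    (fun i a => freePiece (fun j => (𝒜 j).toAddSubgroup) (G.deg i) (F.deg i a))
    (fun a y hy => by
      obtain ⟨z, hz, hzy, -⟩ := H.exists_mem_freePiece G.isGradedBy.aug_mem
        (hy ▸ F.isGradedBy.aug_mem a)
      exact ⟨z, hz, hzy.trans hy⟩)
    (fun i a φ hφ y hy => by
      obtain ⟨z, hz, hzy, -⟩ := H.exists_mem_freePiece_pi (G.isGradedBy.d_mem i)
        (j := F.deg (i + 1) a) (x := y) (by
          rw [hy]
          have := H.map_mem_freePiece (c := 0) (δ := F.deg i) (ε := G.deg i) (f := φ)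
            (fun b => by rw [add_zero]; exact hφ b) (F.isGradedBy.d_mem i a)
          rwa [add_zero] at this)
      exact ⟨z, hz, hzy.trans hy⟩)
  -- Only α has to be homogeneous; β is used just to compare elements modulo 𝔪.
  obtain ⟨β, hβ₀, hβ⟩ := G.toFreeResolution.exists_comparison' F.toFreeResolution
  have hβα := fun x => hF.sub_mem_of_lift_id (fun i => β i ∘ₗ α i) (fun x => by simp [hα₀, hβ₀])
    (fun i x => by simp [hα, hβ]) i x
  have hαpiece : ∀ i, ∀ x ∈ F.piece i j, α i x ∈ G.piece i j := fun i x hx => by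
    have := H.map_mem_freePiece (c := 0) (δ := F.deg i) (ε := G.deg i) (f := α i) (x := x)
      (fun b => by rw [add_zero]; exact hαQ i b) hx
    rwa [add_zero] at this
  -- Minimality of F kills the differential modulo 𝔪, so α sends basis vectors to cycles of k ⊗ G.
  have hcycle : ∀ i c, (Submodule.Quotient.mk (((α i).restrictScalars k).restrict (hαpiece i)
      (F.degreePart i j c)) : G.red i j) ∈ G.redZ j i := by
    rintro (_ | i) c
    · trivial
    · refine (Submodule.Quotient.mk_eq_zero _).2 ?_
      change G.d i (α (i + 1) _) ∈ G.maxPart i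
      rw [hα]
      exact map_mem_smul_top _ _ (hF.d_mem _ _)
  let f : ({a // F.deg i a = j} → k) →ₗ[k] G.tor i j :=
    Submodule.mkQ _ ∘ₗ LinearMap.codRestrict (G.redZ j i)
      (Submodule.mkQ _ ∘ₗ ((α i).restrictScalars k).restrict (hαpiece i) ∘ₗ F.degreePart i j)
      (hcycle i)
  -- If α(c) is a boundary modulo 𝔪, applying β shows βα(c) ∈ 𝔪F; as βα ≡ id, the scalars c lie in 𝔪
  -- and vanish.
  have hf : Function.Injective f := by
    rw [injective_iff_map_eq_zero]
    intro c hc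
    obtain ⟨z, hz⟩ := (Submodule.Quotient.mk_eq_zero _).1 hc
    obtain ⟨⟨w, hw⟩, rfl⟩ := Submodule.Quotient.mk_surjective _ z
    have h1 : G.d i w - α i (F.degreePart i j c) ∈ G.maxPart i :=
      (Submodule.Quotient.eq ((G.maxPart i).submoduleOf (G.piece i j))).1 hz
    have h2 : β i (G.d i w - α i (F.degreePart i j c)) ∈ F.maxPart i :=
      map_mem_smul_top _ (β i) h1
    rw [map_sub, ← hβ] at h2
    have h3 : F.d i (β (i + 1) w) ∈ F.maxPart i := hF.d_mem _ _
    have h4 : β i (α i (F.degreePart i j c)) - (F.degreePart i j c : F.X i) ∈ F.maxPart i :=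
      hβα _
    have h5 : (F.degreePart i j c : F.X i) ∈ F.maxPart i := by
      have := sub_mem (sub_mem h3 h2) h4
      rwa [sub_sub_cancel, sub_sub_cancel] at this
    ext a
    have h6 := (mem_maxPart_iff F).1 h5 a
    change (if h : F.deg i a = j then algebraMap k R (c ⟨a, h⟩) else 0) ∈ _ at h6
    rw [dif_pos a.2] at h6
    exact h𝒜.eq_zero_of_algebraMap_mem h6
  -- Finiteness matters: `finrank` would be 0 on an infinite-dimensional space.
  have := G.finite_tor h𝒜 i j
  rw [← card_eq_degCount, ← Module.finrank_fintype_fun_eq_card k]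
  exact LinearMap.finrank_le_finrank_of_injective hf

/-- The graded Betti numbers count the basis elements in a minimal graded resolution. -/
lemma gradedBetti_eq_degCount (h𝒜 : IsStandardGraded 𝒜)
    (H : HomogeneousProjections (gradedMaximalIdeal 𝒜) (fun j => (𝒜 j).toAddSubgroup) ℳ)
    (F : GradedFreeResolution 𝒜 ℳ) (hF : F.IsMinimal (gradedMaximalIdeal 𝒜)) (i : ℕ) (j : ℤ) :
    gradedBetti 𝒜 ℳ i j = degCount (F.deg i) j := by
  have : Nonempty (GradedFreeResolution 𝒜 ℳ) := ⟨F⟩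
  refine le_antisymm ((ciInf_le' _ F).trans (F.finrank_tor_le h𝒜 i j)) (le_ciInf fun G => ?_)
  exact degCount_le_finrank_tor h𝒜 H F G hF i j

/-- The total Betti numbers are the ranks in a minimal graded resolution. -/
lemma totalBetti_eq_rank (h𝒜 : IsStandardGraded 𝒜) (F : GradedFreeResolution 𝒜 ℳ)
    (hF : F.IsMinimal (gradedMaximalIdeal 𝒜)) (s : ℕ) : totalBetti 𝒜 ℳ s = F.rank s := by
  have : Nonempty (GradedMinRes 𝒜 ℳ) := ⟨⟨F, hF⟩⟩
  refine le_antisymm (ciInf_le' (fun F : GradedMinRes 𝒜 ℳ => F.1.rank s) ⟨F, hF⟩)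
    (le_ciInf fun G => ?_)
  exact hF.rank_le h𝒜.gradedMaximalIdeal_ne_top G.1.toFreeResolution s

end GradedFreeResolution

/-! ### Relations among minimal generators -/

section Generators

variable {R : Type u} [CommRing R] {M : Type u} [AddCommGroup M] [Module R M] {t : ℕ}
  {m : Fin t → M} {𝔪 : Ideal R}

/-- No coefficient of a relation among minimal generators is a unit. -/
lemma IsMinimalGenerators.not_isUnit (hm : IsMinimalGenerators (R := R) m) {b : Fin t → R}
    (hb : ∑ j, b j • m j = 0) (j : Fin t) : ¬ IsUnit (b j) := by
  intro hj
  refine hm.2 j ?_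
  have hmem : ∀ l ≠ j, m l ∈ Submodule.span R (m '' {j}ᶜ) := fun l hl =>
    Submodule.subset_span ⟨l, hl, rfl⟩
  rw [← Finset.add_sum_erase _ _ (Finset.mem_univ j)] at hb
  have h1 : b j • m j ∈ Submodule.span R (m '' {j}ᶜ) := by
    rw [eq_neg_of_add_eq_zero_left hb]
    exact neg_mem (sum_mem fun l hl => Submodule.smul_mem _ _ (hmem l (Finset.ne_of_mem_erase hl)))
  have h2 : m j ∈ Submodule.span R (m '' {j}ᶜ) := by
    obtain ⟨u, hu⟩ := hj
    rw [← hu] at h1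
    have := Submodule.smul_mem _ ((u⁻¹ : Rˣ) : R) h1
    rwa [smul_smul, Units.inv_mul, one_smul] at this
  rw [← top_le_iff, ← hm.1, Submodule.span_le]
  rintro _ ⟨l, rfl⟩
  by_cases hl : l = j
  · exact hl ▸ h2
  · exact hmem l hl

lemma IsMinimalGenerators.initial_eq_top (hm : IsMinimalGenerators (R := R) m) :
    initial R m t = ⊤ :=
  initial_self.trans hm.1

lemma IsMinimalGenerators.nonempty_fin [Nontrivial M] (hm : IsMinimalGenerators (R := R) m) :
    Nonempty (Fin t) := by
  by_contra h
  rw [not_nonempty_iff] at h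
  have := hm.1
  rw [Set.range_eq_empty, Submodule.span_empty] at this
  exact bot_ne_top this

lemma sum_filter_lt_self (f : Fin t → ℕ) :
    ∑ l ∈ ({l | (l : ℕ) < t} : Finset (Fin t)), f l = ∑ l, f l := by
  simp

end Generators

/-- Transport of a resolution along an isomorphism. -/
def FreeResolution.congr {R : Type u} [CommRing R] {M N : Type u} [AddCommGroup M] [Module R M]
    [AddCommGroup N] [Module R N] (F : FreeResolution R N) (e : N ≃ₗ[R] M) :
    FreeResolution R M where
  rank := F.rank
  d := F.d
  aug := e.toLinearMap ∘ₗ F.aug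
  aug_surjective := e.surjective.comp F.aug_surjective
  exact_zero x := by
    rw [← F.exact_zero x]
    exact e.map_eq_zero_iff
  exact_succ := F.exact_succ

/-! ### The local case -/

section LocalCase

variable {R : Type u} [CommRing R] [IsLocalRing R] {M : Type u} [AddCommGroup M] [Module R M]

/-- An empty infimum in `ℕ∞` is ⊤, so vanishing forces a minimal resolution to exist, and the
infimum is attained. -/
lemma isKoszul_iff : IsKoszul R M ↔ ∃ F : FreeResolution R M,
    F.IsMinimal (IsLocalRing.maximalIdeal R) ∧ F.IsLinear (IsLocalRing.maximalIdeal R) := by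
  constructor
  · intro h
    rw [IsKoszul, linearityDefect] at h
    have hne : Nonempty (MinRes R M) := by
      by_contra hne
      rw [not_nonempty_iff] at hne
      rw [iInf_of_empty] at h
      exact absurd h (by simp)
    obtain ⟨F, hF⟩ := ciInf_mem fun F : MinRes R M => FreeResolution.linDefect F.2
    rw [h] at hF
    exact ⟨F.1, F.2, (FreeResolution.linDefect_eq_zero_iff F.2).1 hF⟩
  · rintro ⟨F, hF, hlin⟩
    rw [IsKoszul, linearityDefect, ← le_zero_iff]
    exact (iInf_le _ (⟨F, hF⟩ : MinRes R M)).trans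
      ((FreeResolution.linDefect_eq_zero_iff hF).2 hlin).le

lemma betti_eq_rank {F : FreeResolution R M} (hF : F.IsMinimal (IsLocalRing.maximalIdeal R))
    (s : ℕ) : betti R M s = F.rank s := by
  have : Nonempty (MinRes R M) := ⟨⟨F, hF⟩⟩
  refine le_antisymm (ciInf_le' (fun F : MinRes R M => F.1.rank s) ⟨F, hF⟩)
    (le_ciInf fun G => ?_)
  exact hF.rank_le (IsLocalRing.maximalIdeal.isMaximal R).ne_top G.1 s

/-- The family in which every element is homogeneous of every degree. -/
def HomogeneousProjections.trivial {R : Type u} [CommRing R] {M : Type u} [AddCommGroup M]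
    [Module R M] (𝔪 : Ideal R) :
    HomogeneousProjections 𝔪 (fun _ => ⊤) (fun _ => (⊤ : AddSubgroup M)) where
  mul_mem _ _ := AddSubgroup.mem_top _
  smul_mem _ _ := AddSubgroup.mem_top _
  proj _ := AddMonoidHom.id R
  proj_mem _ _ := AddSubgroup.mem_top _
  proj_of_mem _ := rfl
  proj_mul _ _ _ := rfl
  proj_mem_ideal _ h := h
  projM _ := AddMonoidHom.id M
  projM_of_mem _ := rfl
  projM_smul _ _ _ := rfl

theorem linear_quotients_local [Nontrivial M] {t : ℕ} {m : Fin t → M}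
    (hm : IsMinimalGenerators (R := R) m) (hK : ∀ i, IsKoszul R (R ⧸ colonIdeal R m i)) :
    (∀ i : ℕ, i ≤ t → IsKoszul R (initial R m i)) ∧ IsKoszul R M ∧
      (∀ s : ℕ, betti R M s = ∑ i, betti R (R ⧸ colonIdeal R m i) s) ∧
      projDim R M = ⨆ i, projDim R (R ⧸ colonIdeal R m i) := by
  have hrel : ∀ b : Fin t → R, ∑ j, b j • m j = 0 → ∀ j, b j ∈ IsLocalRing.maximalIdeal R :=
    fun b hb j => (IsLocalRing.mem_maximalIdeal _).2 (hm.not_isUnit hb j)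
  have h𝔪 := (IsLocalRing.maximalIdeal.isMaximal R).ne_top
  choose G hmin hlin using fun i => isKoszul_iff.1 (hK i)
  have hF := exists_linear_resolution_initial (HomogeneousProjections.trivial (M := M) _)
    (d := 0) (fun _ => AddSubgroup.mem_top _) hrel (δ := fun _ _ _ => 0) hmin hlin
    (fun l => ⟨fun i a b => AddSubgroup.mem_top _, fun a => by
      obtain ⟨r, hr⟩ := Submodule.mkQ_surjective _ ((G l).aug (Pi.single a 1))
      exact ⟨r, AddSubgroup.mem_top _, hr⟩⟩)
  obtain ⟨F, -, hFmin, hFlin, -, hFrank, -⟩ := hF t le_rfl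
  let F' : FreeResolution R M := F.congr (LinearEquiv.ofTop _ hm.initial_eq_top)
  have hF'min : F'.IsMinimal (IsLocalRing.maximalIdeal R) := hFmin
  have hrank : ∀ s, F'.rank s = ∑ l, (G l).rank s := fun s =>
    (hFrank s).trans (sum_filter_lt_self _)
  have := hm.nonempty_fin
  have : ∀ l, Nontrivial (R ⧸ colonIdeal R m l) := fun l =>
    Ideal.Quotient.nontrivial_iff.2 (colonIdeal_ne_top h𝔪 hrel l)
  refine ⟨fun i hi => ?_, isKoszul_iff.2 ⟨F', hF'min, hFlin⟩, fun s => ?_,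
    projDim_eq_iSup h𝔪 hF'min hmin hrank⟩
  · obtain ⟨F, -, hFmin, hFlin, -⟩ := hF i hi
    exact isKoszul_iff.2 ⟨F, hFmin, hFlin⟩
  · rw [betti_eq_rank hF'min, hrank]
    exact Finset.sum_congr rfl fun l _ => (betti_eq_rank (hmin l) s).symm

end LocalCase

/-! ### The graded case -/

section GradedCase

variable {k : Type v} [Field k] {R : Type u} [CommRing R] [Algebra k R]
  {𝒜 : ℤ → Submodule k R} {M : Type u} [AddCommGroup M] [Module R M] {ℳ : ℤ → AddSubgroup M}

lemma isGradedKoszul_iff : IsGradedKoszul 𝒜 ℳ ↔ ∃ F : GradedFreeResolution 𝒜 ℳ,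
    F.IsMinimal (gradedMaximalIdeal 𝒜) ∧ F.IsLinear (gradedMaximalIdeal 𝒜) := by
  constructor
  · intro h
    rw [IsGradedKoszul, gradedLinearityDefect] at h
    have hne : Nonempty (GradedMinRes 𝒜 ℳ) := by
      by_contra hne
      rw [not_nonempty_iff] at hne
      rw [iInf_of_empty] at h
      exact absurd h (by simp)
    obtain ⟨F, hF⟩ := ciInf_mem fun F : GradedMinRes 𝒜 ℳ => FreeResolution.linDefect F.2
    rw [h] at hF
    exact ⟨F.1, F.2, (FreeResolution.linDefect_eq_zero_iff F.2).1 hF⟩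
  · rintro ⟨F, hF, hlin⟩
    rw [IsGradedKoszul, gradedLinearityDefect, ← le_zero_iff]
    exact (iInf_le _ (⟨F, hF⟩ : GradedMinRes 𝒜 ℳ)).trans
      ((FreeResolution.linDefect_eq_zero_iff hF).2 hlin).le

/-- Projecting x m_l = ∑ b_i m_i to degree j + d_l expresses x_j m_l through the same generators.
Homogeneity of I_l is what gives R/I_l its projections. -/
lemma HomogeneousProjections.proj_mem_colonIdeal {𝔪 : Ideal R} {𝒜 : ℤ → AddSubgroup R}
    (H : HomogeneousProjections 𝔪 𝒜 ℳ) {t : ℕ} {m : Fin t → M} {d : Fin t → ℤ}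
    (hm : ∀ l, m l ∈ ℳ (d l)) (l : Fin t) (j : ℤ) (x : R) (hx : x ∈ colonIdeal R m l) :
    H.proj j x ∈ colonIdeal R m l := by
  rw [mem_colonIdeal_iff] at hx ⊢
  obtain ⟨b, hb, hbx⟩ := exists_sum_eq_of_mem_initial hx
  have h1 := congrArg (H.projM (j + d l)) hbx
  rw [H.projM_smul _ _ (hm l), add_sub_cancel_right, map_sum] at h1
  rw [← h1]
  refine sum_mem fun i _ => ?_
  rw [H.projM_smul _ _ (hm i)]
  rcases lt_or_ge i l with hi | hi
  · exact Submodule.smul_mem _ _ (mem_initial_of_lt hi)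
  · rw [hb i hi, map_zero, zero_smul]
    exact zero_mem _

/-- The degree d_j component of a relation is again a relation, whose coefficient at j is the
degree-zero part of b_j; were b_j outside 𝔪, this would be a unit. -/
lemma IsStandardGraded.mem_of_relation [GradedAlgebra 𝒜] [DirectSum.Decomposition ℳ]
    [SetLike.GradedSMul 𝒜 ℳ] (h𝒜 : IsStandardGraded 𝒜) {t : ℕ} {m : Fin t → M} {d : Fin t → ℤ}
    (hmd : ∀ l, m l ∈ ℳ (d l)) (hm : IsMinimalGenerators (R := R) m) (b : Fin t → R)
    (hb : ∑ j, b j • m j = 0) (j : Fin t) : b j ∈ gradedMaximalIdeal 𝒜 := by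
  by_contra hj
  let H := h𝒜.projections ℳ
  have h1 := congrArg (H.projM (d j)) hb
  rw [map_sum, map_zero] at h1
  simp only [H.projM_smul _ _ (hmd _)] at h1
  refine hm.not_isUnit h1 j ?_
  rw [sub_self]
  exact h𝒜.isUnit_proj_zero hj

/-- Regularity of a module whose graded Betti numbers are the sums of shifted ones. -/
lemma regularity_eq_iSup [GradedAlgebra 𝒜] {ι : Type*} [Fintype ι] {N : ι → Type u}
    [∀ l, AddCommGroup (N l)] [∀ l, Module R (N l)] {𝒩 : ∀ l, ℤ → AddSubgroup (N l)} {d : ι → ℤ}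
    (h : ∀ s j, gradedBetti 𝒜 ℳ s j = ∑ l, gradedBetti 𝒜 (𝒩 l) s (j - d l)) :
    regularity 𝒜 ℳ = ⨆ l, (regularity 𝒜 (𝒩 l) + (((d l : ℤ) : ℝ) : EReal)) := by
  apply le_antisymm
  · refine iSup_le fun s => iSup_le fun j => iSup_le fun hsj => ?_
    rw [h] at hsj
    obtain ⟨l, -, hl⟩ := Finset.exists_ne_zero_of_sum_ne_zero hsj
    refine le_iSup_of_le l ?_
    have h1 : ((((j - d l) - s : ℤ) : ℝ) : EReal) ≤ regularity 𝒜 (𝒩 l) :=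
      le_iSup_of_le s (le_iSup_of_le (j - d l) (le_iSup_of_le hl le_rfl))
    refine le_trans (le_of_eq ?_) (add_le_add_left h1 _)
    rw [← EReal.coe_add]
    refine congrArg Real.toEReal ?_
    push_cast
    ring
  · refine iSup_le fun l => ?_
    -- The shift d_l is finite, so it can be moved across the inequality, exposing the supremum.
    rw [← EReal.le_sub_iff_add_le (Or.inl (EReal.coe_ne_bot _)) (Or.inl (EReal.coe_ne_top _))]
    refine iSup_le fun s => iSup_le fun j => iSup_le fun hsj => ?_
    rw [EReal.le_sub_iff_add_le (Or.inl (EReal.coe_ne_bot _)) (Or.inl (EReal.coe_ne_top _))]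
    have h1 : gradedBetti 𝒜 ℳ s (j + d l) ≠ 0 := by
      rw [h]
      intro h0
      have := Finset.sum_eq_zero_iff.1 h0 l (Finset.mem_univ l)
      rw [add_sub_cancel_right] at this
      exact hsj this
    refine le_iSup_of_le s (le_iSup_of_le (j + d l) (le_iSup_of_le h1 (le_of_eq ?_)))
    rw [← EReal.coe_add]
    refine congrArg Real.toEReal ?_
    push_cast
    ring

theorem linear_quotients_graded [GradedAlgebra 𝒜] (h𝒜 : IsStandardGraded 𝒜) [Nontrivial M]
    [DirectSum.Decomposition ℳ] [SetLike.GradedSMul 𝒜 ℳ] {t : ℕ} {m : Fin t → M} {d : Fin t → ℤ}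
    (hmd : ∀ i, m i ∈ ℳ (d i)) (hm : IsMinimalGenerators (R := R) m)
    (hK : ∀ i, IsGradedKoszul 𝒜 (quotGrading 𝒜 (colonIdeal R m i))) :
    (∀ i : ℕ, i ≤ t → IsGradedKoszul 𝒜 (subGrading ℳ (initial R m i))) ∧
      IsGradedKoszul 𝒜 ℳ ∧
      (∀ s : ℕ, totalBetti 𝒜 ℳ s = ∑ i, totalBetti 𝒜 (quotGrading 𝒜 (colonIdeal R m i)) s) ∧
      projDim R M = (⨆ i, projDim R (R ⧸ colonIdeal R m i)) ∧
      (∀ (s : ℕ) (j : ℤ), gradedBetti 𝒜 ℳ s j =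
        ∑ i, gradedBetti 𝒜 (quotGrading 𝒜 (colonIdeal R m i)) s (j - d i)) := by
  have hrel := h𝒜.mem_of_relation hmd hm
  have h𝔪 := h𝒜.gradedMaximalIdeal_ne_top
  let H := h𝒜.projections ℳ
  choose G hmin hlin using fun i => isGradedKoszul_iff.1 (hK i)
  have hF := exists_linear_resolution_initial H hmd hrel (δ := fun l => (G l).deg) hmin hlin
    (fun l => (G l).isGradedBy)
  obtain ⟨F, deg, hFmin, hFlin, hFgr, hFrank, hFcount⟩ := hF t le_rfl
  let F' : GradedFreeResolution 𝒜 ℳ := .ofIsGradedBy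
    (F.congr (LinearEquiv.ofTop _ hm.initial_eq_top)) (deg := deg) ⟨hFgr.d_mem, hFgr.aug_mem⟩
  have hF'min : F'.IsMinimal (gradedMaximalIdeal 𝒜) := hFmin
  have hrank : ∀ s, F'.rank s = ∑ l, (G l).rank s := fun s =>
    (hFrank s).trans (sum_filter_lt_self _)
  have hcount : ∀ s j, degCount (F'.deg s) j = ∑ l, degCount ((G l).deg s) (j - d l) :=
    fun s j => (hFcount s j).trans (sum_filter_lt_self _)
  have := hm.nonempty_fin
  have : ∀ l, Nontrivial (R ⧸ colonIdeal R m l) := fun l =>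
    Ideal.Quotient.nontrivial_iff.2 (colonIdeal_ne_top h𝔪 hrel l)
  refine ⟨fun i hi => ?_, isGradedKoszul_iff.2 ⟨F', hF'min, hFlin⟩, fun s => ?_,
    projDim_eq_iSup h𝔪 hF'min hmin hrank, fun s j => ?_⟩
  · obtain ⟨F, deg, hFmin, hFlin, hFgr, -⟩ := hF i hi
    exact isGradedKoszul_iff.2 ⟨.ofIsGradedBy F hFgr, hFmin, hFlin⟩
  · rw [F'.totalBetti_eq_rank h𝒜 hF'min, hrank]
    exact Finset.sum_congr rfl fun l _ => ((G l).totalBetti_eq_rank h𝒜 (hmin l) s).symm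
  · rw [F'.gradedBetti_eq_degCount h𝒜 H hF'min, hcount]
    exact Finset.sum_congr rfl fun l _ => ((G l).gradedBetti_eq_degCount h𝒜
      (H.quotient _ (H.proj_mem_colonIdeal hmd l)) (hmin l) s _).symm

end GradedCase

end LinQuot

end

theorem proposition5p11 :
    -- the local case
    (∀ (R : Type u) [CommRing R] [IsLocalRing R] [IsNoetherianRing R]
        (M : Type u) [AddCommGroup M] [Module R M] [Nontrivial M]
        (t : ℕ) (m : Fin t → M),
      LinQuot.IsMinimalGenerators (R := R) m →
      (∀ i, LinQuot.IsKoszul R (R ⧸ LinQuot.colonIdeal R m i)) →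
        (∀ i : ℕ, 1 ≤ i → i ≤ t → LinQuot.IsKoszul R (LinQuot.initial R m i)) ∧
        LinQuot.IsKoszul R M ∧
        (∀ s : ℕ, LinQuot.betti R M s =
          ∑ i, LinQuot.betti R (R ⧸ LinQuot.colonIdeal R m i) s) ∧
        LinQuot.projDim R M = ⨆ i, LinQuot.projDim R (R ⧸ LinQuot.colonIdeal R m i)) ∧
    -- the graded case
    (∀ (k : Type v) [Field k] (R : Type u) [CommRing R] [Algebra k R]
        (𝒜 : ℤ → Submodule k R) [GradedAlgebra 𝒜],
      LinQuot.IsStandardGraded 𝒜 →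
      ∀ (M : Type u) [AddCommGroup M] [Module R M] [Nontrivial M]
        (ℳ : ℤ → AddSubgroup M) [DirectSum.Decomposition ℳ] [SetLike.GradedSMul 𝒜 ℳ]
        (t : ℕ) (m : Fin t → M) (d : Fin t → ℤ),
      (∀ i, m i ∈ ℳ (d i)) →
      LinQuot.IsMinimalGenerators (R := R) m →
      (∀ i, LinQuot.IsGradedKoszul 𝒜 (LinQuot.quotGrading 𝒜 (LinQuot.colonIdeal R m i))) →
        (∀ i : ℕ, 1 ≤ i → i ≤ t →
          LinQuot.IsGradedKoszul 𝒜 (LinQuot.subGrading ℳ (LinQuot.initial R m i))) ∧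
        LinQuot.IsGradedKoszul 𝒜 ℳ ∧
        (∀ s : ℕ, LinQuot.totalBetti 𝒜 ℳ s =
          ∑ i, LinQuot.totalBetti 𝒜 (LinQuot.quotGrading 𝒜 (LinQuot.colonIdeal R m i)) s) ∧
        LinQuot.projDim R M = (⨆ i, LinQuot.projDim R (R ⧸ LinQuot.colonIdeal R m i)) ∧
        (∀ (s : ℕ) (j : ℤ), LinQuot.gradedBetti 𝒜 ℳ s j =
          ∑ i, LinQuot.gradedBetti 𝒜 (LinQuot.quotGrading 𝒜 (LinQuot.colonIdeal R m i)) s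
            (j - d i)) ∧
        LinQuot.regularity 𝒜 ℳ =
          ⨆ i, (LinQuot.regularity 𝒜 (LinQuot.quotGrading 𝒜 (LinQuot.colonIdeal R m i)) +
            (((d i : ℤ) : ℝ) : EReal))) := by
  refine ⟨fun R _ _ _ M _ _ _ t m hm hK => ?_,
    fun k _ R _ _ 𝒜 _ h𝒜 M _ _ _ ℳ _ _ t m d hmd hm hK => ?_⟩
  · obtain ⟨h1, h2⟩ := LinQuot.linear_quotients_local hm hK
    exact ⟨fun i _ hi => h1 i hi, h2⟩
  · obtain ⟨h1, h2, h3, h4, h5⟩ := LinQuot.linear_quotients_graded h𝒜 hmd hm hK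
    exact ⟨fun i _ hi => h1 i hi, h2, h3, h4, h5, LinQuot.regularity_eq_iSup h5⟩
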